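/- Let $m\ge 1$ and $0\le n<N$ be integers, and let $\zeta_j=e^{ij\pi/N}$, $j=-N+1,\dots,N$. For a sequence $M=(M_0,\dots,M_n)$ of complex $m\times m$ matrices with $M_0$ Hermitian put $M_{-k}=M_k^*$ and $M(\zeta)=\sum_{k=-n}^n M_k\zeta^{-k}$, and let $$\mathbf M=\sum_{k=-n}^n S^{-k}\otimes M_k$$ be the corresponding banded $2mN\times 2mN$ block-circulant matrix of order $n$, where $S$ is the $2N\times 2N$ cyclic shift matrix (ones on the superdiagonal and in the lower left corner). Let $\mathfrak P_+^{(m,n)}(N)$ be the cone of all such sequences (identified with their pseudo-polynomials) for which $M(\zeta_j)$ is positive definite for all $j$, and let $\mathfrak C_+^{(m,n)}(N)$ be the dual cone of all such sequences $C=(C_0,\dots,C_n)$ with $$\langle C,Q\rangle:=\sum_{k=-n}^n\operatorname{tr}(C_kQ_k^*)>0\quad\text{for all nonzero } Q \text{ in the closure of } \mathfrak P_+^{(m,n)}(N).$$ Let $C\in\mathfrak C_+^{(m,n)}(N)$, let $\mathbf C$ be the corresponding banded block-circulant matrix, and let $\mathbf T_n=[C_{i-j}]_{i,j=0}^n$ be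 the corresponding block-Toeplitz matrix. Let $P(\zeta)=\sum_{k=-n}^n p_k\zeta^{-k}\in\mathfrak P_+^{(1,n)}(N)$ be a scalar pseudo-polynomial, $p_{-k}=\bar p_k$, with positive-definite banded block-circulant matrix $\mathbf P=\sum_{k=-n}^n S^{-k}\otimes p_kI_m$. Then: (i) There is a unique sequence $Q=(Q_0,\dots,Q_n)$ of $m\times m$ matrices such that the banded block-circulant matrix $\mathbf Q=\sum_{k=-n}^n S^{-k}\otimes Q_k$, $Q_{-k}=Q_k^*$, is positive definite and $\boldsymbol\Sigma=\mathbf Q^{-1}\mathbf P$ is a block-circulant extension of $\mathbf C$, i.e. $\boldsymbol\Sigma=\sum_{k=-N+1}^N S^{-k}\otimes C_k$ for some extension $C_{n+1},\dots,C_N$ of $C$ with $C_{-k}=C_k^*$ (indices modulo $2N$). (ii) This $\boldsymbol\Sigma$ is the unique maximizer of $\mathcal I_{\mathbf P}(\boldsymbol\Sigma)=\operatorname{tr}(\mathbf P\log\boldsymbol\Sigma)$ over all positive-definite (Hermitian) $2mN\times 2mN$ block-circulant matrices $\boldsymbol\Sigma$ subject to $\mathbf E_n^{\mathsf T}\boldsymbol\Sigma\mathbf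 E_n=\mathbf T_n$, where $\mathbf E_n=\begin{bmatrix}\mathbf I_{m(n+1)}\\ 0\end{bmatrix}$ is $2mN\times m(n+1)$. (iii) $\mathbf Q$ is the unique minimizer of $\mathcal J_{\mathbf P}(\mathbf Q)=\operatorname{tr}(\mathbf C\mathbf Q)-\operatorname{tr}(\mathbf P\log\mathbf Q)$ over all positive-definite banded $2mN\times 2mN$ block-circulant matrices $\mathbf Q$ of order $n$, and the functional $\mathcal J_{\mathbf P}$ is strictly convex on this set. -/

import Mathlib

open scoped Kronecker Matrix ComplexOrder

noncomputable section

namespace BlockCirculant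

/-- Coefficient data `(M_0, …, M_n)` of `m × m` complex matrices. -/
abbrev Coeffs (m n : ℕ) : Type := Fin (n + 1) → Matrix (Fin m) (Fin m) ℂ

/-- The two-sided sequence of `(M_0, …, M_n)`: `M_k` for `0 ≤ k ≤ n`, `M_k = M_{-k}ᴴ` for
`-n ≤ k < 0`, and `0` for `|k| > n`. -/
def lag {m n : ℕ} (M : Coeffs m n) (k : ℤ) : Matrix (Fin m) (Fin m) ℂ :=
  if h : k.natAbs < n + 1 then
    (if 0 ≤ k then M ⟨k.natAbs, h⟩ else (M ⟨k.natAbs, h⟩)ᴴ)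
  else 0

/-- The point `ζ_j = exp(i j π / N)` of the discrete unit circle. -/
def zeta (N : ℕ) (j : ℤ) : ℂ :=
  Complex.exp (Complex.I * ((j : ℂ) * (Real.pi : ℂ) / (N : ℂ)))

/-- The pseudo-polynomial `M(z) = ∑_{k=-n}^{n} M_k z^{-k}`. -/
def symbol {m n : ℕ} (M : Coeffs m n) (z : ℂ) : Matrix (Fin m) (Fin m) ℂ :=
  ∑ k ∈ Finset.Icc (-(n : ℤ)) (n : ℤ), z ^ (-k) • lag M k

/-- The cone of `m × m` Hermitian pseudo-polynomials of degree at most `n` (given by their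
coefficients) that are positive definite at the points `ζ_{-N+1}, …, ζ_N`. -/
def posCone (m n N : ℕ) : Set (Coeffs m n) :=
  {Q | (Q 0).IsHermitian ∧
    ∀ j ∈ Finset.Icc (-(N : ℤ) + 1) (N : ℤ), (symbol Q (zeta N j)).PosDef}

/-- `⟨C, Q⟩ = ∑_{k=-n}^{n} tr (C_k Q_kᴴ)`, a real number when `C_0` and `Q_0` are Hermitian. -/
def pairing {m n : ℕ} (C Q : Coeffs m n) : ℝ :=
  (∑ k ∈ Finset.Icc (-(n : ℤ)) (n : ℤ), (lag C k * (lag Q k)ᴴ).trace).re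

/-- The dual cone: all `C` that pair strictly positively with every nonzero element of the
closure of `posCone m n N`. -/
def dualCone (m n N : ℕ) : Set (Coeffs m n) :=
  {C | (C 0).IsHermitian ∧ ∀ Q ∈ closure (posCone m n N), Q ≠ 0 → 0 < pairing C Q}

/-- The `2N × 2N` cyclic shift matrix: ones on the superdiagonal and in the lower left corner. -/
def shift (N : ℕ) : Matrix (Fin (2 * N)) (Fin (2 * N)) ℂ :=
  Matrix.of fun i j => if (j : ℕ) = ((i : ℕ) + 1) % (2 * N) then 1 else 0

/-- Complex `2mN × 2mN` matrices, with rows and columns indexed by (block, position in block). -/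
abbrev BigMatrix (m N : ℕ) : Type :=
  Matrix (Fin (2 * N) × Fin m) (Fin (2 * N) × Fin m) ℂ

/-- The banded block-circulant matrix `∑_{k=-n}^{n} S^{-k} ⊗ M_k` of order `n`. -/
def banded {m n : ℕ} (N : ℕ) (M : Coeffs m n) : BigMatrix m N :=
  ∑ k ∈ Finset.Icc (-(n : ℤ)) (n : ℤ), (shift N ^ (-k) : Matrix (Fin (2 * N)) (Fin (2 * N)) ℂ) ⊗ₖ lag M k

/-- The block-circulant matrix `∑_{k=-N+1}^{N} S^{-k} ⊗ M_k`. -/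
def blockCirc {m : ℕ} (N : ℕ) (M : ℤ → Matrix (Fin m) (Fin m) ℂ) : BigMatrix m N :=
  ∑ k ∈ Finset.Icc (-(N : ℤ) + 1) (N : ℤ), (shift N ^ (-k) : Matrix (Fin (2 * N)) (Fin (2 * N)) ℂ) ⊗ₖ M k

/-- `M` is `2N`-periodic and Hermitian, `M_{-k} = M_kᴴ`. -/
def IsHermitianLags {m : ℕ} (N : ℕ) (M : ℤ → Matrix (Fin m) (Fin m) ℂ) : Prop :=
  (∀ k, M (k + 2 * (N : ℤ)) = M k) ∧ ∀ k, M (-k) = (M k)ᴴ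

/-- `A` is a Hermitian block-circulant matrix. -/
def IsBlockCirculant {m N : ℕ} (A : BigMatrix m N) : Prop :=
  ∃ M : ℤ → Matrix (Fin m) (Fin m) ℂ, IsHermitianLags N M ∧ A = blockCirc N M

/-- `A` is a (Hermitian) block-circulant extension of the banded matrix with coefficients `C`:
it is block-circulant and its lags of index `0, …, n` are `C_0, …, C_n`. -/
def IsExtension {m n N : ℕ} (C : Coeffs m n) (A : BigMatrix m N) : Prop :=
  ∃ M : ℤ → Matrix (Fin m) (Fin m) ℂ, IsHermitianLags N M ∧
    (∀ k : Fin (n + 1), M ((k : ℕ) : ℤ) = C k) ∧ A = blockCirc N M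

/-- The block-Toeplitz matrix with blocks `C_{i-j}`, `0 ≤ i, j ≤ n`. -/
def toeplitz {m n : ℕ} (C : Coeffs m n) :
    Matrix (Fin (n + 1) × Fin m) (Fin (n + 1) × Fin m) ℂ :=
  Matrix.of fun x y => lag C (((x.1 : ℕ) : ℤ) - ((y.1 : ℕ) : ℤ)) x.2 y.2

/-- The matrix `E_n` whose first `n + 1` block rows form the identity and whose other block rows
vanish. -/
def embed (m n N : ℕ) : Matrix (Fin (2 * N) × Fin m) (Fin (n + 1) × Fin m) ℂ :=
  Matrix.of fun x y => if (x.1 : ℕ) = (y.1 : ℕ) ∧ x.2 = y.2 then 1 else 0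

/-- The scalar coefficients `p_0, …, p_n` read as the matrices `p_0 I_m, …, p_n I_m`. -/
def scalarCoeffs {n : ℕ} (m : ℕ) (p : Fin (n + 1) → ℂ) : Coeffs m n :=
  fun k => p k • (1 : Matrix (Fin m) (Fin m) ℂ)

/-- The logarithm of a Hermitian positive definite matrix, by functional calculus. -/
def matrixLog {m N : ℕ} (A : BigMatrix m N) : BigMatrix m N := cfc Real.log A

/-- `tr (P log Σ)`; this trace is real when `P` and `Σ` are Hermitian. -/
def primal {m N : ℕ} (P Sig : BigMatrix m N) : ℝ := (P * matrixLog Sig).trace.re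

/-- `tr (C Q) - tr (P log Q)`; both traces are real when `C`, `P` and `Q` are Hermitian. -/
def dual {m N : ℕ} (C P Q : BigMatrix m N) : ℝ :=
  (C * Q).trace.re - (P * matrixLog Q).trace.re

/-- The feasible set of the primal problem: positive definite block-circulant matrices `Σ` with
`E_nᵀ Σ E_n = T_n`. -/
def primalSet {m n : ℕ} (N : ℕ) (C : Coeffs m n) : Set (BigMatrix m N) :=
  {Sig | Sig.PosDef ∧ IsBlockCirculant Sig ∧
    (embed m n N)ᵀ * Sig * embed m n N = toeplitz C}

/-- The positive definite banded block-circulant matrices of order `n`. (Positive definiteness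
includes being Hermitian.) -/
def dualSet (m n N : ℕ) : Set (BigMatrix m N) :=
  {A | A.PosDef ∧ ∃ Q : Coeffs m n, A = banded N Q}

end BlockCirculant

end

open BlockCirculant

/-! One inequality drives everything: if `P`, `X`, `Y` are positive definite and `P` commutes with
`X`, then tr(P log Y) ≤ tr(P log X) + tr(P X⁻¹ (Y − X)), strictly unless Y = X
(`Matrix.PosDef.trace_mul_log_lt`). With P = R² and spectral decompositions of X and Y it becomes a
sum of log t ≤ t − 1 at t = y_j / x_i, with weights |(Uᴴ R V)_{ij}|². Since `P` has scalar blocks,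
it commutes with every block-circulant matrix, so the tangent bound holds at every point of the dual
set and at Σ = Q⁻¹P. It replaces differentiation of the logarithm throughout.

Existence comes from the dual problem. Compactness of a trace-one slice turns membership in the dual
cone into c · tr Q ≤ tr(CQ). A tangent bound at a multiple of the identity then bounds the trace on
sublevel sets, and P ≥ ε > 0 keeps the eigenvalues away from 0 (`exists_sublevel_bounds`). The
tangents also give lower semicontinuity, so a minimizer exists (`exists_minimizer`). At a minimizer
C − Q⁻¹P is orthogonal to all Hermitian banded directions; testing against its own band forces the
lags −n, …, n to agree (`isExtension_of_isMin`).

Conversely, if Q⁻¹P extends `C`, the tangent inequality at `Q` makes `Q` the strict dual minimizer,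
which gives uniqueness. At X = Q⁻¹P the slope P X⁻¹ equals `Q`, which is banded and cannot
distinguish two extensions of `C`, so Q⁻¹P is the strict primal maximizer. -/

namespace Matrix

variable {ι : Type*} [Fintype ι] [DecidableEq ι]

/-! ### Spectral calculus and the tangent inequality for tr(P log X). -/

/-- Spectral form of the functional calculus of a Hermitian matrix. -/
lemma IsHermitian.cfc_eq_mul_diagonal_mul {A : Matrix ι ι ℂ} (hA : A.IsHermitian) (f : ℝ → ℝ) :
    cfc f A = (hA.eigenvectorUnitary : Matrix ι ι ℂ) *
      diagonal (fun i => (f (hA.eigenvalues i) : ℂ)) * (hA.eigenvectorUnitary : Matrix ι ι ℂ)ᴴ := by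
  rw [hA.cfc_eq, IsHermitian.cfc, Unitary.conjStarAlgAut_apply]
  rfl

lemma IsHermitian.eq_mul_diagonal_mul {A : Matrix ι ι ℂ} (hA : A.IsHermitian) :
    A = (hA.eigenvectorUnitary : Matrix ι ι ℂ) *
      diagonal (fun i => (hA.eigenvalues i : ℂ)) * (hA.eigenvectorUnitary : Matrix ι ι ℂ)ᴴ := by
  conv_lhs => rw [hA.spectral_theorem, Unitary.conjStarAlgAut_apply]
  rfl

lemma IsHermitian.eigenvectorUnitary_mul_conjTranspose {A : Matrix ι ι ℂ} (hA : A.IsHermitian) :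
    (hA.eigenvectorUnitary : Matrix ι ι ℂ) * (hA.eigenvectorUnitary : Matrix ι ι ℂ)ᴴ = 1 :=
  Unitary.coe_mul_star_self _

lemma IsHermitian.conjTranspose_mul_eigenvectorUnitary {A : Matrix ι ι ℂ} (hA : A.IsHermitian) :
    (hA.eigenvectorUnitary : Matrix ι ι ℂ)ᴴ * (hA.eigenvectorUnitary : Matrix ι ι ℂ) = 1 :=
  Unitary.coe_star_mul_self _

/-- `tr (R (U D_a Uᴴ) R (V D_b Vᴴ)) = ∑ a_i b_j |(Uᴴ R V)_{ij}|²` for Hermitian `R`. -/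
lemma trace_sandwich_eq_sum {R : Matrix ι ι ℂ} (hR : R.IsHermitian) (U V : Matrix ι ι ℂ)
    (a b : ι → ℝ) :
    (R * (U * diagonal (fun i => (a i : ℂ)) * Uᴴ) * R *
      (V * diagonal (fun i => (b i : ℂ)) * Vᴴ)).trace.re =
      ∑ i, ∑ j, a i * b j * ‖(Uᴴ * R * V) i j‖ ^ 2 := by
  have h1 : (R * (U * diagonal (fun i => (a i : ℂ)) * Uᴴ) * R *
      (V * diagonal (fun i => (b i : ℂ)) * Vᴴ)).trace =
      (diagonal (fun i => (a i : ℂ)) * (Uᴴ * R * V) * diagonal (fun i => (b i : ℂ)) *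
        (Uᴴ * R * V)ᴴ).trace := by
    rw [conjTranspose_mul, conjTranspose_mul, hR.eq, conjTranspose_conjTranspose]
    rw [show R * (U * diagonal (fun i => (a i : ℂ)) * Uᴴ) * R *
      (V * diagonal (fun i => (b i : ℂ)) * Vᴴ) = (R * U) * (diagonal (fun i => (a i : ℂ)) * Uᴴ * R *
      (V * diagonal (fun i => (b i : ℂ)) * Vᴴ)) by simp only [Matrix.mul_assoc], trace_mul_comm]
    simp only [Matrix.mul_assoc]
  rw [h1]
  generalize Uᴴ * R * V = W
  rw [trace, Complex.re_sum]
  refine Finset.sum_congr rfl fun i _ => ?_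
  rw [diag_apply, Matrix.mul_apply, Complex.re_sum]
  refine Finset.sum_congr rfl fun j _ => ?_
  rw [mul_diagonal, diagonal_mul, conjTranspose_apply]
  rw [show (a i : ℂ) * W i j * b j * star (W i j) = ((a i * b j : ℝ) : ℂ) * (W i j * star (W i j))
    by push_cast; ring]
  rw [Complex.star_def, Complex.mul_conj, Complex.normSq_eq_norm_sq, ← Complex.ofReal_mul,
    Complex.ofReal_re]

/-- Being a function of `P`, the root inherits every commutation relation of `P`; it is invertible
because its square is. -/
lemma PosDef.exists_sqrt {P : Matrix ι ι ℂ} (hP : P.PosDef) :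
    ∃ R : Matrix ι ι ℂ, R.IsHermitian ∧ R * R = P ∧ IsUnit R ∧ ∀ X, Commute P X → Commute R X := by
  have hRR : cfc Real.sqrt P * cfc Real.sqrt P = P := by
    conv_rhs => rw [hP.isHermitian.eq_mul_diagonal_mul]
    rw [← cfc_mul .., hP.isHermitian.cfc_eq_mul_diagonal_mul]
    congr 3
    ext i
    rw [Real.mul_self_sqrt (hP.eigenvalues_pos i).le]
  refine ⟨cfc Real.sqrt P, cfc_predicate (R := ℝ) (p := IsSelfAdjoint) _ P, hRR, ?_,
    fun X h => h.cfc_real _⟩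
  have := hP.isUnit
  rw [← hRR] at this
  exact ((Commute.refl _).isUnit_mul_iff.mp this).1

lemma PosDef.inv_eq_mul_diagonal_mul {X : Matrix ι ι ℂ} (hX : X.PosDef) :
    X⁻¹ = (hX.isHermitian.eigenvectorUnitary : Matrix ι ι ℂ) *
      diagonal (fun i => ((hX.isHermitian.eigenvalues i)⁻¹ : ℝ) : ι → ℂ) *
        (hX.isHermitian.eigenvectorUnitary : Matrix ι ι ℂ)ᴴ := by
  apply inv_eq_right_inv
  set U := (hX.isHermitian.eigenvectorUnitary : Matrix ι ι ℂ) with hU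
  have hXe : X = U * diagonal (fun i => (hX.isHermitian.eigenvalues i : ℂ)) * Uᴴ :=
    hX.isHermitian.eq_mul_diagonal_mul
  have h1 : Uᴴ * U = 1 := hX.isHermitian.conjTranspose_mul_eigenvectorUnitary
  have h2 : U * Uᴴ = 1 := hX.isHermitian.eigenvectorUnitary_mul_conjTranspose
  have h3 : diagonal (fun i => (hX.isHermitian.eigenvalues i : ℂ)) *
      diagonal (fun i => ((hX.isHermitian.eigenvalues i)⁻¹ : ℝ) : ι → ℂ) = 1 := by
    rw [diagonal_mul_diagonal, ← diagonal_one]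
    congr 1
    ext i
    rw [← Complex.ofReal_mul, mul_inv_cancel₀ (hX.eigenvalues_pos i).ne', Complex.ofReal_one]
  calc X * (U * diagonal (fun i => ((hX.isHermitian.eigenvalues i)⁻¹ : ℝ) : ι → ℂ) * Uᴴ)
      = U * diagonal (fun i => (hX.isHermitian.eigenvalues i : ℂ)) * Uᴴ *
        (U * diagonal (fun i => ((hX.isHermitian.eigenvalues i)⁻¹ : ℝ) : ι → ℂ) * Uᴴ) :=
        congrArg (· * _) hXe
    _ = U * diagonal (fun i => (hX.isHermitian.eigenvalues i : ℂ)) * (Uᴴ * U) *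
        diagonal (fun i => ((hX.isHermitian.eigenvalues i)⁻¹ : ℝ) : ι → ℂ) * Uᴴ := by
        simp only [Matrix.mul_assoc]
    _ = U * (diagonal (fun i => (hX.isHermitian.eigenvalues i : ℂ)) *
        diagonal (fun i => ((hX.isHermitian.eigenvalues i)⁻¹ : ℝ) : ι → ℂ)) * Uᴴ := by
        rw [h1]; simp only [Matrix.mul_assoc, Matrix.one_mul]
    _ = 1 := by rw [h3, Matrix.mul_one, h2]

lemma PosDef.commute_inv_right {P X : Matrix ι ι ℂ} (hX : X.PosDef) (h : Commute P X) :
    Commute P X⁻¹ := by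
  have hd : IsUnit X.det := (isUnit_iff_isUnit_det X).mp hX.isUnit
  calc P * X⁻¹ = X⁻¹ * X * P * X⁻¹ := by rw [nonsing_inv_mul _ hd, Matrix.one_mul]
    _ = X⁻¹ * (P * X) * X⁻¹ := by rw [h.eq, Matrix.mul_assoc X⁻¹]
    _ = X⁻¹ * P := by
      rw [Matrix.mul_assoc, Matrix.mul_assoc, mul_nonsing_inv _ hd, Matrix.mul_one]

/-- Strict first-order concavity of `X ↦ tr (P log X)` at a point commuting with `P`. -/
theorem PosDef.trace_mul_log_lt {P X Y : Matrix ι ι ℂ} (hP : P.PosDef) (hX : X.PosDef)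
    (hY : Y.PosDef) (hPX : Commute P X) (hne : Y ≠ X) :
    (P * cfc Real.log Y).trace.re <
      (P * cfc Real.log X).trace.re + (P * X⁻¹ * (Y - X)).trace.re := by
  obtain ⟨R, hR, hRR, hRu, hRc⟩ := hP.exists_sqrt
  set U := (hX.isHermitian.eigenvectorUnitary : Matrix ι ι ℂ) with hU
  set V := (hY.isHermitian.eigenvectorUnitary : Matrix ι ι ℂ) with hV
  set x := hX.isHermitian.eigenvalues with hx
  set y := hY.isHermitian.eigenvalues with hy
  have hx0 : ∀ i, 0 < x i := fun i => hX.eigenvalues_pos i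
  have hy0 : ∀ i, 0 < y i := fun i => hY.eigenvalues_pos i
  have hUU : U * Uᴴ = 1 := hX.isHermitian.eigenvectorUnitary_mul_conjTranspose
  have hVV : V * Vᴴ = 1 := hY.isHermitian.eigenvectorUnitary_mul_conjTranspose
  have hXe : X = U * diagonal (fun i => (x i : ℂ)) * Uᴴ := hX.isHermitian.eq_mul_diagonal_mul
  have hYe : Y = V * diagonal (fun i => (y i : ℂ)) * Vᴴ := hY.isHermitian.eq_mul_diagonal_mul
  have hXi : X⁻¹ = U * diagonal (fun i => ((x i)⁻¹ : ℝ) : ι → ℂ) * Uᴴ := hX.inv_eq_mul_diagonal_mul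
  have hU1 : U * diagonal (fun _ => ((1 : ℝ) : ℂ)) * Uᴴ = 1 := by simp [hUU]
  have hV1 : V * diagonal (fun _ => ((1 : ℝ) : ℂ)) * Vᴴ = 1 := by simp [hVV]
  set W := Uᴴ * R * V with hW
  -- Writing the identity as U 1 Uᴴ or V 1 Vᴴ puts all the traces into sandwich form with the same
  -- weights ‖W i j‖².
  have e1 : (P * cfc Real.log Y).trace.re =
      ∑ i, ∑ j, 1 * Real.log (y j) * ‖W i j‖ ^ 2 := by
    rw [← trace_sandwich_eq_sum hR U V (fun _ => 1), hU1, Matrix.mul_one, hRR,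
      hY.isHermitian.cfc_eq_mul_diagonal_mul]
  have e2 : (P * cfc Real.log X).trace.re =
      ∑ i, ∑ j, Real.log (x i) * 1 * ‖W i j‖ ^ 2 := by
    rw [← trace_sandwich_eq_sum hR U V _ (fun _ => 1), hV1, Matrix.mul_one,
      trace_mul_cycle, hRR, hX.isHermitian.cfc_eq_mul_diagonal_mul]
  have hcX : R * X⁻¹ = X⁻¹ * R := hX.commute_inv_right (hRc X hPX)
  have hPXi : P * X⁻¹ = R * X⁻¹ * R := by
    rw [← hRR, Matrix.mul_assoc, Matrix.mul_assoc, hcX]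
  have e3 : (P * X⁻¹ * (Y - X)).trace.re =
      ∑ i, ∑ j, (x i)⁻¹ * y j * ‖W i j‖ ^ 2 - ∑ i, ∑ j, 1 * 1 * ‖W i j‖ ^ 2 := by
    rw [← trace_sandwich_eq_sum hR U V, ← hXi, ← hYe,
      ← trace_sandwich_eq_sum hR U V (fun _ => 1) (fun _ => 1), hU1, hV1, Matrix.mul_sub, trace_sub,
      hPXi, Complex.sub_re, ← hPXi, Matrix.mul_one, Matrix.mul_one, hRR,
      Matrix.mul_assoc P X⁻¹ X, nonsing_inv_mul _ ((isUnit_iff_isUnit_det X).mp hX.isUnit), Matrix.mul_one]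
  -- This is log t ≤ t − 1 at t = y j / x i, with equality only at t = 1.
  have key : ∀ i j, 0 ≤ (Real.log (x i) + (x i)⁻¹ * y j - 1 - Real.log (y j)) ∧
      (y j ≠ x i → 0 < (Real.log (x i) + (x i)⁻¹ * y j - 1 - Real.log (y j))) := by
    intro i j
    have hpos : 0 < (x i)⁻¹ * y j := mul_pos (inv_pos.mpr (hx0 i)) (hy0 j)
    have hlog : Real.log ((x i)⁻¹ * y j) = Real.log (y j) - Real.log (x i) := by
      rw [Real.log_mul (inv_pos.mpr (hx0 i)).ne' (hy0 j).ne', Real.log_inv]; ring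
    constructor
    · have := Real.log_le_sub_one_of_pos hpos
      linarith
    · intro h
      have := Real.log_lt_sub_one_of_pos hpos (fun h1 => h (by
        have := (hx0 i).ne'
        field_simp at h1
        exact h1))
      linarith
  -- If `W` were supported where y j = x i, it would intertwine the two spectra, so XR = RY. As `R`
  -- commutes with `X` and is invertible, this forces X = Y.
  have hexists : ∃ i j, W i j ≠ 0 ∧ y j ≠ x i := by
    by_contra! hcon
    apply hne
    have hWD : diagonal (fun i => (x i : ℂ)) * W = W * diagonal (fun i => (y i : ℂ)) := by
      ext i j
      rw [diagonal_mul, mul_diagonal]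
      by_cases h0 : W i j = 0
      · simp [h0]
      · rw [hcon i j h0, mul_comm]
    have h1 : X * R = R * Y := by
      calc X * R = U * (diagonal (fun i => (x i : ℂ)) * W) * Vᴴ := by
            conv_lhs => rw [hXe, ← Matrix.mul_one R, ← hVV]
            simp only [hW, Matrix.mul_assoc]
        _ = (U * Uᴴ) * R * (V * diagonal (fun i => (y i : ℂ)) * Vᴴ) := by
            rw [hWD]; simp only [hW, Matrix.mul_assoc]
        _ = R * Y := by rw [hUU, Matrix.one_mul, ← hYe]
    have h2 : R * X = R * Y := (hRc X hPX).eq.trans h1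
    exact (hRu.mul_left_cancel h2).symm
  have hsum : (P * cfc Real.log X).trace.re + (P * X⁻¹ * (Y - X)).trace.re -
      (P * cfc Real.log Y).trace.re =
      ∑ i, ∑ j, (Real.log (x i) + (x i)⁻¹ * y j - 1 - Real.log (y j)) * ‖W i j‖ ^ 2 := by
    rw [e1, e2, e3, ← Finset.sum_sub_distrib, ← Finset.sum_add_distrib, ← Finset.sum_sub_distrib]
    refine Finset.sum_congr rfl fun i _ => ?_
    rw [← Finset.sum_sub_distrib, ← Finset.sum_add_distrib, ← Finset.sum_sub_distrib]
    refine Finset.sum_congr rfl fun j _ => ?_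
    ring
  obtain ⟨i₀, j₀, hw, hne'⟩ := hexists
  have hnn : ∀ i j, 0 ≤ (Real.log (x i) + (x i)⁻¹ * y j - 1 - Real.log (y j)) * ‖W i j‖ ^ 2 :=
    fun i j => mul_nonneg (key i j).1 (sq_nonneg _)
  have : 0 < ∑ i, ∑ j, (Real.log (x i) + (x i)⁻¹ * y j - 1 - Real.log (y j)) * ‖W i j‖ ^ 2 :=
    Finset.sum_pos' (fun i _ => Finset.sum_nonneg fun j _ => hnn i j)
      ⟨i₀, Finset.mem_univ _, Finset.sum_pos' (fun j _ => hnn i₀ j) ⟨j₀, Finset.mem_univ _,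
        mul_pos ((key i₀ j₀).2 hne') (pow_pos (norm_pos_iff.mpr hw) 2)⟩⟩
  linarith

theorem PosDef.trace_mul_log_le {P X Y : Matrix ι ι ℂ} (hP : P.PosDef) (hX : X.PosDef)
    (hY : Y.PosDef) (hPX : Commute P X) :
    (P * cfc Real.log Y).trace.re ≤
      (P * cfc Real.log X).trace.re + (P * X⁻¹ * (Y - X)).trace.re := by
  by_cases h : Y = X
  · subst h; simp
  · exact (hP.trace_mul_log_lt hX hY hPX h).le

/-! ### Quantitative bounds for positive matrices. -/

/-- The entries of a positive semidefinite matrix are bounded by its trace. -/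
lemma PosSemidef.norm_apply_le_trace {A : Matrix ι ι ℂ} (hA : A.PosSemidef) (i j : ι) :
    ‖A i j‖ ≤ A.trace.re := by
  have hU : ∀ i j, ‖(hA.isHermitian.eigenvectorUnitary : Matrix ι ι ℂ) i j‖ ≤ 1 :=
    fun i j => entry_norm_bound_of_unitary (hA.isHermitian.eigenvectorUnitary).2 i j
  have htr : A.trace.re = ∑ k, hA.isHermitian.eigenvalues k := by
    rw [hA.isHermitian.trace_eq_sum_eigenvalues]
    simp
  rw [htr]
  conv_lhs => rw [hA.isHermitian.eq_mul_diagonal_mul]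
  rw [Matrix.mul_apply]
  refine (norm_sum_le _ _).trans (Finset.sum_le_sum fun k _ => ?_)
  rw [mul_diagonal, conjTranspose_apply, norm_mul, norm_mul, norm_star, Complex.norm_real,
    Real.norm_of_nonneg (hA.eigenvalues_nonneg k)]
  have := hA.eigenvalues_nonneg k
  calc _ ≤ 1 * hA.isHermitian.eigenvalues k * 1 := by
        gcongr
        · exact hU _ _
        · exact hU _ _
    _ = _ := by ring

/-- A Hermitian matrix dominates any lower bound of its eigenvalues. -/
lemma IsHermitian.posSemidef_sub_smul_one {A : Matrix ι ι ℂ} (hA : A.IsHermitian) {δ : ℝ}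
    (h : ∀ i, δ ≤ hA.eigenvalues i) : (A - (δ : ℂ) • (1 : Matrix ι ι ℂ)).PosSemidef := by
  have : A - (δ : ℂ) • (1 : Matrix ι ι ℂ) = (hA.eigenvectorUnitary : Matrix ι ι ℂ) *
      diagonal (fun i => ((hA.eigenvalues i - δ : ℝ) : ℂ)) *
        (hA.eigenvectorUnitary : Matrix ι ι ℂ)ᴴ := by
    rw [show (fun i => ((hA.eigenvalues i - δ : ℝ) : ℂ)) =
      (fun i => (hA.eigenvalues i : ℂ) - (fun _ => (δ : ℂ)) i) by ext; push_cast; rfl,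
      ← diagonal_sub, Matrix.mul_sub, Matrix.sub_mul, ← hA.eq_mul_diagonal_mul,
      ← smul_one_eq_diagonal, Matrix.mul_smul, Matrix.smul_mul, Matrix.mul_one,
      hA.eigenvectorUnitary_mul_conjTranspose]
  rw [this]
  refine PosSemidef.mul_mul_conjTranspose_same (PosSemidef.diagonal fun i => ?_) _
  simpa using h i

lemma PosDef.exists_posSemidef_sub_smul_one {A : Matrix ι ι ℂ} (hA : A.PosDef) :
    ∃ δ : ℝ, 0 < δ ∧ (A - (δ : ℂ) • (1 : Matrix ι ι ℂ)).PosSemidef := by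
  cases isEmpty_or_nonempty ι
  · exact ⟨1, one_pos, hA.isHermitian.posSemidef_sub_smul_one fun i => isEmptyElim i⟩
  · obtain ⟨i₀, h₀⟩ := Finite.exists_min hA.isHermitian.eigenvalues
    exact ⟨_, hA.eigenvalues_pos i₀, hA.isHermitian.posSemidef_sub_smul_one h₀⟩

lemma PosSemidef.posDef_of_sub_smul_one {κ : Type*} [DecidableEq κ] {A : Matrix κ κ ℂ} {δ : ℝ} (hδ : 0 < δ)
    (h : (A - (δ : ℂ) • (1 : Matrix κ κ ℂ)).PosSemidef) : A.PosDef := by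
  have h1 : ((δ : ℂ) • (1 : Matrix κ κ ℂ)).PosDef := PosDef.one.smul (by simpa using hδ)
  simpa using h1.posSemidef_add h

/-- For commuting positive definite matrices `X⁻¹ P` is positive definite. -/
lemma PosDef.inv_mul_of_commute {P X : Matrix ι ι ℂ} (hP : P.PosDef) (hX : X.PosDef)
    (h : Commute P X) : (X⁻¹ * P).PosDef := by
  obtain ⟨R, hR, hRR, hRu, hRc⟩ := hP.exists_sqrt
  have h1 : X⁻¹ * P = star R * X⁻¹ * R := by
    rw [star_eq_conjTranspose, hR.eq, (hX.commute_inv_right (hRc X h)).eq, Matrix.mul_assoc, hRR]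
  rw [h1]
  exact (IsUnit.posDef_star_left_conjugate_iff hRu).mpr hX.inv

/-- If `P ≥ ε` and `0 < A` has trace at most `τ`, a lower bound of `tr (P log A)` bounds the
eigenvalues of `A` from below. -/
lemma PosDef.mul_log_eigenvalue_ge {P A : Matrix ι ι ℂ} (hP : P.PosDef) (hA : A.PosDef) {ε τ : ℝ}
    (hε : (P - (ε : ℂ) • (1 : Matrix ι ι ℂ)).PosSemidef) (hτ : A.trace.re ≤ τ) (i : ι) :
    (P * cfc Real.log A).trace.re ≤
      ε * (Real.log (hA.isHermitian.eigenvalues i) - Real.log τ) + Real.log τ * P.trace.re := by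
  set V := (hA.isHermitian.eigenvectorUnitary : Matrix ι ι ℂ) with hV
  set y := hA.isHermitian.eigenvalues with hy
  have hy0 : ∀ i, 0 < y i := fun i => hA.eigenvalues_pos i
  have hVV : V * Vᴴ = 1 := hA.isHermitian.eigenvectorUnitary_mul_conjTranspose
  have hVV' : Vᴴ * V = 1 := hA.isHermitian.conjTranspose_mul_eigenvectorUnitary
  have hyτ : ∀ j, y j ≤ τ := by
    intro j
    have htr : A.trace.re = ∑ k, y k := by
      rw [hA.isHermitian.trace_eq_sum_eigenvalues]
      simp [hy]
    rw [htr] at hτ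
    exact (Finset.single_le_sum (fun k _ => (hy0 k).le) (Finset.mem_univ j)).trans hτ
  set w : ι → ℝ := fun j => ((Vᴴ * P * V) j j).re with hw
  have hwε : ∀ j, ε ≤ w j := by
    intro j
    have h := (hε.conjTranspose_mul_mul_same V).diag_nonneg (i := j)
    rw [Matrix.mul_sub, Matrix.sub_mul, Matrix.mul_smul, Matrix.smul_mul, Matrix.mul_one, hVV',
      sub_apply, smul_apply, one_apply_eq] at h
    have := (Complex.le_def.mp h).1
    simp at this
    exact this
  have hlog : (P * cfc Real.log A).trace.re = ∑ j, Real.log (y j) * w j := by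
    rw [hA.isHermitian.cfc_eq_mul_diagonal_mul, ← hV, ← hy,
      ← Matrix.mul_assoc, trace_mul_comm, ← Matrix.mul_assoc, ← Matrix.mul_assoc, trace,
      Complex.re_sum]
    refine Finset.sum_congr rfl fun j _ => ?_
    rw [diag_apply, mul_diagonal, mul_comm, Complex.re_ofReal_mul]
  have htrP : P.trace.re = ∑ j, w j := by
    rw [hw, ← Complex.re_sum]
    change _ = (trace (Vᴴ * P * V)).re
    rw [trace_mul_comm, ← Matrix.mul_assoc, hVV, Matrix.one_mul]
  -- No eigenvalue exceeds τ, so log y j − log τ is nonpositive and a weight w j ≥ ε can only lower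
  -- the product. All terms but the `i`-th are later dropped for the same sign reason.
  have hterm : ∀ j, (Real.log (y j) - Real.log τ) * w j ≤ ε * (Real.log (y j) - Real.log τ) := by
    intro j
    have : Real.log (y j) ≤ Real.log τ := Real.log_le_log (hy0 j) (hyτ j)
    nlinarith [hwε j]
  have hw0 : ∀ j, 0 ≤ w j := fun j => by
    have h := (hP.posSemidef.conjTranspose_mul_mul_same V).diag_nonneg (i := j)
    exact (Complex.le_def.mp h).1
  have hle0 : ∀ j, (Real.log (y j) - Real.log τ) * w j ≤ 0 := by
    intro j
    have : Real.log (y j) ≤ Real.log τ := Real.log_le_log (hy0 j) (hyτ j)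
    exact mul_nonpos_of_nonpos_of_nonneg (by linarith) (hw0 j)
  have hsplit : ∑ j, Real.log (y j) * w j =
      ∑ j, (Real.log (y j) - Real.log τ) * w j + Real.log τ * ∑ j, w j := by
    rw [Finset.mul_sum, ← Finset.sum_add_distrib]
    exact Finset.sum_congr rfl fun j _ => by ring
  rw [hlog, htrP, hsplit]
  gcongr
  rw [← Finset.add_sum_erase _ _ (Finset.mem_univ i)]
  have := Finset.sum_nonpos (s := Finset.univ.erase i) fun j _ => hle0 j
  linarith [hterm i]

end Matrix

noncomputable section

namespace BlockCirculant

variable {m n N : ℕ}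

/-! ### Cyclic translations modulo 2N. -/

lemma exists_fin_dvd_iff (hN : 0 < N) (z : ℤ) :
    ∃ l : Fin (2 * N), ∀ k : Fin (2 * N), (2 * N : ℤ) ∣ z - (k : ℕ) ↔ k = l := by
  have h2 : (0 : ℤ) < 2 * N := by positivity
  have h0 := Int.emod_nonneg z h2.ne'
  have h1 := Int.emod_lt_of_pos z h2
  have hd := Int.emod_add_mul_ediv z (2 * N)
  refine ⟨⟨(z % (2 * N)).toNat, by omega⟩, fun k => ⟨fun ⟨c, hc⟩ => ?_, fun h => ?_⟩⟩
  · ext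
    have hk : z % (2 * N) = (k : ℕ) := by
      rw [show z = (k : ℕ) + 2 * N * c by linarith, Int.add_mul_emod_self_left]
      exact Int.emod_eq_of_lt (by positivity) (by exact_mod_cast k.2)
    simp [hk]
  · refine ⟨z / (2 * N), ?_⟩
    rw [h]
    push_cast [Int.toNat_of_nonneg h0]
    linarith

/-- The permutation matrix of the cyclic translation by `k`. -/
def translation (N : ℕ) (k : ℤ) : Matrix (Fin (2 * N)) (Fin (2 * N)) ℂ :=
  Matrix.of fun i j => if (2 * N : ℤ) ∣ (i : ℕ) - (j : ℕ) - k then 1 else 0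

lemma translation_apply (k : ℤ) (i j : Fin (2 * N)) :
    translation N k i j = if (2 * N : ℤ) ∣ (i : ℕ) - (j : ℕ) - k then 1 else 0 := rfl

/-- Row `i` of `translation N k` selects the unique index congruent to `i - k`. -/
lemma exists_translation_row (hN : 0 < N) (k : ℤ) (i : Fin (2 * N)) :
    ∃ l : Fin (2 * N), (2 * N : ℤ) ∣ (i : ℕ) - (l : ℕ) - k ∧
      ∀ j, translation N k i j = if j = l then 1 else 0 := by
  obtain ⟨l, hl⟩ := exists_fin_dvd_iff hN ((i : ℕ) - k)
  have h : ∀ j : Fin (2 * N), (2 * N : ℤ) ∣ (i : ℕ) - (j : ℕ) - k ↔ j = l := fun j => by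
    rw [← hl j, sub_right_comm]
  exact ⟨l, (h l).mpr rfl, fun j => by simp [translation_apply, h]⟩

lemma translation_mul (hN : 0 < N) (a b : ℤ) :
    translation N a * translation N b = translation N (a + b) := by
  ext i j
  obtain ⟨l, hl, hrow⟩ := exists_translation_row hN a i
  rw [Matrix.mul_apply]
  simp only [hrow, ite_mul, one_mul, zero_mul, Finset.sum_ite_eq', Finset.mem_univ, if_true,
    translation_apply]
  congr 1
  rw [show ((i : ℕ) : ℤ) - (j : ℕ) - (a + b) = ((i : ℕ) - (l : ℕ) - a) + ((l : ℕ) - (j : ℕ) - b) by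
    ring, eq_iff_iff]
  exact (Int.dvd_add_right hl).symm

lemma translation_zero : translation N 0 = 1 := by
  ext i j
  rw [translation_apply, Matrix.one_apply]
  congr 1
  rw [eq_iff_iff]
  constructor
  · intro h
    have := Int.eq_zero_of_abs_lt_dvd h (by rw [abs_lt]; omega)
    ext; omega
  · rintro rfl; simp

lemma shift_eq_translation : shift N = translation N (-1) := by
  ext i j
  rw [shift, translation_apply, Matrix.of_apply]
  congr 1
  rw [eq_iff_iff]
  have hj := j.2
  constructor
  · intro h
    rw [h]
    refine ⟨(((i : ℕ) + 1) / (2 * N) : ℕ), ?_⟩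
    have := Nat.mod_add_div ((i : ℕ) + 1) (2 * N)
    zify at this
    push_cast
    linarith
  · rintro ⟨c, hc⟩
    have : ((j : ℕ) : ℤ) = ((i : ℕ) + 1) % (2 * N) := by
      rw [show ((i : ℕ) : ℤ) + 1 = (j : ℕ) + 2 * N * c by linarith, Int.add_mul_emod_self_left]
      exact (Int.emod_eq_of_lt (by positivity) (by exact_mod_cast hj)).symm
    exact_mod_cast this

/-- The shift is translation by −1, and translations form a group; the positive `k` need the matrix
inverse. -/
lemma shift_zpow (hN : 0 < N) (k : ℤ) : shift N ^ (-k) = translation N k := by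
  have hpow : ∀ j : ℕ, shift N ^ j = translation N (-j) := by
    intro j
    induction j with
    | zero => simp [translation_zero]
    | succ j ih =>
      rw [pow_succ, ih, shift_eq_translation, translation_mul hN]
      congr 1; push_cast; ring
  obtain ⟨j, rfl | rfl⟩ := k.eq_nat_or_neg
  · rw [Matrix.zpow_neg_natCast, hpow]
    apply Matrix.inv_eq_right_inv
    rw [translation_mul hN, neg_add_cancel, translation_zero]
  · rw [neg_neg, zpow_natCast, hpow]

/-! ### Block-circulant matrices by lags, and the wrapped band. -/

/-- The matrix whose block at position `(i, j)` is `M (i - j)`. -/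
def circ (N : ℕ) (M : ℤ → Matrix (Fin m) (Fin m) ℂ) : BigMatrix m N :=
  Matrix.of fun x y => M ((x.1 : ℕ) - (y.1 : ℕ)) x.2 y.2

lemma circ_apply (M : ℤ → Matrix (Fin m) (Fin m) ℂ) (i j : Fin (2 * N)) (x y : Fin m) :
    circ N M (i, x) (j, y) = M ((i : ℕ) - (j : ℕ)) x y := rfl

lemma periodic_congr {α : Type*} {M : ℤ → α} (hM : ∀ k, M (k + 2 * (N : ℤ)) = M k)
    {a b : ℤ} (h : (2 * N : ℤ) ∣ a - b) : M a = M b := by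
  obtain ⟨c, hc⟩ := h
  have hp : Function.Periodic M (2 * (N : ℤ)) := hM
  have := hp.int_mul c b
  rw [← this]
  congr 1
  simp only [Int.cast_id]
  linarith

/-- The range −N+1, …, N is a complete residue system modulo 2N, so exactly one summand reaches each
block. -/
lemma blockCirc_eq_circ (hN : 0 < N) {M : ℤ → Matrix (Fin m) (Fin m) ℂ}
    (hM : ∀ k, M (k + 2 * (N : ℤ)) = M k) : blockCirc N M = circ N M := by
  ext ⟨i, x⟩ ⟨j, y⟩
  rw [circ_apply, blockCirc, Matrix.sum_apply]
  simp only [shift_zpow hN, Matrix.kroneckerMap_apply, translation_apply, ite_mul, one_mul, zero_mul]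
  obtain ⟨k, hk, hd⟩ : ∃ k ∈ Finset.Icc (-(N : ℤ) + 1) N,
      (2 * N : ℤ) ∣ (i : ℕ) - (j : ℕ) - k := by
    have hi := i.2
    have hj := j.2
    simp only [Finset.mem_Icc]
    by_cases h1 : ((i : ℕ) : ℤ) - (j : ℕ) ≤ N
    · by_cases h2 : -(N : ℤ) + 1 ≤ (i : ℕ) - (j : ℕ)
      · exact ⟨(i : ℕ) - (j : ℕ), ⟨h2, h1⟩, by simp⟩
      · exact ⟨(i : ℕ) - (j : ℕ) + 2 * N, by omega, ⟨-1, by ring⟩⟩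
    · exact ⟨(i : ℕ) - (j : ℕ) - 2 * N, by omega, ⟨1, by ring⟩⟩
  rw [Finset.sum_eq_single k, if_pos hd, periodic_congr hM hd]
  · intro b hb hbk
    rw [if_neg]
    intro hb'
    have h3 : (2 * N : ℤ) ∣ k - b := by
      have := Int.dvd_sub hb' hd
      rwa [show ((i : ℕ) : ℤ) - (j : ℕ) - b - ((i : ℕ) - (j : ℕ) - k) = k - b by ring] at this
    rw [Finset.mem_Icc] at hb hk
    have := Int.eq_zero_of_abs_lt_dvd h3 (by rw [abs_lt]; omega)
    omega
  · exact fun h => absurd hk h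

/-- The `2N`-periodic wrapping of a banded sequence. -/
def wrap (N : ℕ) (Q : Coeffs m n) (k : ℤ) : Matrix (Fin m) (Fin m) ℂ :=
  ∑ l ∈ Finset.Icc (-(n : ℤ)) n, if (2 * N : ℤ) ∣ k - l then lag Q l else 0

lemma wrap_periodic (Q : Coeffs m n) (k : ℤ) : wrap N Q (k + 2 * (N : ℤ)) = wrap N Q k := by
  refine Finset.sum_congr rfl fun l _ => ?_
  congr 1
  rw [eq_iff_iff, show k + 2 * (N : ℤ) - l = k - l + 2 * N by ring]
  exact dvd_add_self_right

lemma banded_eq_sum (hN : 0 < N) (Q : Coeffs m n) :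
    banded N Q = ∑ k ∈ Finset.Icc (-(n : ℤ)) n, translation N k ⊗ₖ lag Q k := by
  simp only [banded, shift_zpow hN]

lemma banded_eq_circ (hN : 0 < N) (Q : Coeffs m n) : banded N Q = circ N (wrap N Q) := by
  ext ⟨i, x⟩ ⟨j, y⟩
  rw [circ_apply, banded_eq_sum hN, wrap, Matrix.sum_apply, Matrix.sum_apply]
  refine Finset.sum_congr rfl fun k _ => ?_
  rw [Matrix.kroneckerMap_apply, translation_apply]
  split_ifs <;> simp

/-- Two indices in [−n, n] differ by at most 2n < 2N, so the band does not overlap itself when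
wrapped. This is where n < N matters. -/
lemma wrap_eq_lag (hnN : n < N) (Q : Coeffs m n) {k : ℤ} (hk : k ∈ Finset.Icc (-(n : ℤ)) n) :
    wrap N Q k = lag Q k := by
  rw [wrap, Finset.sum_eq_single k]
  · simp
  · intro l hl hlk
    rw [if_neg]
    intro h
    rw [Finset.mem_Icc] at hl hk
    have := Int.eq_zero_of_abs_lt_dvd h (by rw [abs_lt]; omega)
    omega
  · exact fun h => absurd hk h

lemma lag_natCast (Q : Coeffs m n) (k : Fin (n + 1)) : lag Q ((k : ℕ) : ℤ) = Q k := by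
  have h : ((k : ℕ) : ℤ).natAbs < n + 1 := by simpa using k.2
  rw [lag, dif_pos h, if_pos (by positivity)]
  rfl

lemma lag_zero (Q : Coeffs m n) : lag Q 0 = Q 0 := by simpa using lag_natCast Q 0

lemma lag_neg {Q : Coeffs m n} (hQ : (Q 0).IsHermitian) (k : ℤ) : lag Q (-k) = (lag Q k)ᴴ := by
  rcases lt_trichotomy k 0 with h | rfl | h
  · simp only [lag, Int.natAbs_neg, not_le.mpr h, if_false, show 0 ≤ -k by omega, if_true]
    split_ifs <;> simp
  · rw [neg_zero, lag_zero, hQ.eq]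
  · simp only [lag, Int.natAbs_neg, h.le, show ¬ 0 ≤ -k by omega, if_false, if_true]
    split_ifs <;> simp

/-- Hermitian lags that agree with `C` at `0, …, n` agree with it at `-n, …, n`. -/
lemma eq_lag_of_natCast {C : Coeffs m n} (hC : (C 0).IsHermitian)
    {M : ℤ → Matrix (Fin m) (Fin m) ℂ} (hM : ∀ k, M (-k) = (M k)ᴴ)
    (h : ∀ k : Fin (n + 1), M ((k : ℕ) : ℤ) = C k) {k : ℤ}
    (hk : k ∈ Finset.Icc (-(n : ℤ)) n) : M k = lag C k := by
  rw [Finset.mem_Icc] at hk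
  obtain ⟨j, rfl | rfl⟩ := k.eq_nat_or_neg
  · have := h ⟨j, by omega⟩
    rw [← lag_natCast C] at this
    exact this
  · have := h ⟨j, by omega⟩
    rw [← lag_natCast C] at this
    rw [hM, lag_neg hC]
    exact congrArg _ this

lemma wrap_neg {Q : Coeffs m n} (hQ : (Q 0).IsHermitian) (k : ℤ) :
    wrap N Q (-k) = (wrap N Q k)ᴴ := by
  rw [wrap, wrap, Matrix.conjTranspose_sum]
  refine Finset.sum_bij' (fun l _ => -l) (fun l _ => -l) ?_ ?_ ?_ ?_ ?_
  · intro l hl; rw [Finset.mem_Icc] at *; omega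
  · intro l hl; rw [Finset.mem_Icc] at *; omega
  · simp
  · simp
  · intro l _
    have : (2 * N : ℤ) ∣ k - -l ↔ (2 * N : ℤ) ∣ -k - l := by
      rw [← dvd_neg, neg_sub, show -l - k = -k - l by ring]
    simp only [this, lag_neg hQ]
    split_ifs <;> simp

lemma circ_isHermitian {M : ℤ → Matrix (Fin m) (Fin m) ℂ} (hM : ∀ k, M (-k) = (M k)ᴴ) :
    (circ N M).IsHermitian := by
  ext ⟨i, x⟩ ⟨j, y⟩
  rw [Matrix.conjTranspose_apply, circ_apply, circ_apply,
    show ((i : ℕ) : ℤ) - (j : ℕ) = -((j : ℕ) - (i : ℕ)) by ring, hM, Matrix.conjTranspose_apply]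

/-- The coefficients can be read off the first block column; injectivity of `banded` and bounds on
the coefficients both rest on this. -/
lemma banded_block (hnN : n < N) (Q : Coeffs m n) (k : Fin (n + 1)) (x y : Fin m) :
    banded N Q (⟨k, by omega⟩, x) (⟨0, by omega⟩, y) = Q k x y := by
  rw [banded_eq_circ (by omega), circ_apply, ← lag_natCast Q k, ← wrap_eq_lag hnN]
  · simp
  · rw [Finset.mem_Icc]; omega

lemma banded_injective (hnN : n < N) :
    Function.Injective (banded N : Coeffs m n → BigMatrix m N) := by
  intro Q Q' h
  funext k
  ext x y
  rw [← banded_block hnN Q, ← banded_block hnN Q', h]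

lemma isHermitian_zero_of_banded (hnN : n < N) {Q : Coeffs m n} (h : (banded N Q).IsHermitian) :
    (Q 0).IsHermitian := by
  ext x y
  have := congrFun (congrFun h (⟨0, by omega⟩, x)) (⟨0, by omega⟩, y)
  rw [Matrix.conjTranspose_apply] at this
  have h1 := banded_block hnN Q 0
  simp only [Fin.val_zero] at h1
  rw [h1, h1] at this
  rw [Matrix.conjTranspose_apply, this]

lemma lag_add (Q Q' : Coeffs m n) (k : ℤ) : lag (Q + Q') k = lag Q k + lag Q' k := by
  simp only [lag]
  split_ifs <;> simp

lemma lag_smul (r : ℝ) (Q : Coeffs m n) (k : ℤ) : lag (r • Q) k = r • lag Q k := by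
  simp only [lag]
  split_ifs <;> simp [Matrix.conjTranspose_smul]

/-- `banded` as a real-linear map. -/
def bandedLinear (m n N : ℕ) : Coeffs m n →ₗ[ℝ] BigMatrix m N where
  toFun := banded N
  map_add' Q Q' := by
    simp only [banded, lag_add, Matrix.kronecker_add, Finset.sum_add_distrib]
  map_smul' r Q := by
    simp only [banded, lag_smul, Matrix.kronecker_smul, Finset.smul_sum, RingHom.id_apply]

lemma banded_add (Q Q' : Coeffs m n) : banded N (Q + Q') = banded N Q + banded N Q' :=
  (bandedLinear m n N).map_add Q Q'

lemma banded_sub (Q Q' : Coeffs m n) : banded N (Q - Q') = banded N Q - banded N Q' :=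
  (bandedLinear m n N).map_sub Q Q'

lemma banded_smul (r : ℝ) (Q : Coeffs m n) : banded N (r • Q) = r • banded N Q :=
  (bandedLinear m n N).map_smul r Q

lemma continuous_banded : Continuous (banded N : Coeffs m n → BigMatrix m N) :=
  (bandedLinear m n N).continuous_of_finiteDimensional

/-! ### Trace pairing, commutation and recognition of block-circulant matrices. -/

/-- `tr (M H)` for a block-circulant `M` and a banded block-circulant `H`. -/
lemma trace_circ_mul_banded (hN : 0 < N) {M : ℤ → Matrix (Fin m) (Fin m) ℂ}
    (hM : ∀ k, M (k + 2 * (N : ℤ)) = M k) (H : Coeffs m n) :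
    (circ N M * banded N H).trace =
      2 * N * ∑ k ∈ Finset.Icc (-(n : ℤ)) n, (M (-k) * lag H k).trace := by
  rw [banded_eq_sum hN, Matrix.mul_sum, Matrix.trace_sum, Finset.mul_sum]
  refine Finset.sum_congr rfl fun k _ => ?_
  generalize lag H k = B
  rw [Matrix.trace_mul_comm]
  have hrow : ∀ i : Fin (2 * N),
      ∑ x, (translation N k ⊗ₖ B * circ N M) (i, x) (i, x) = (M (-k) * B).trace := by
    intro i
    obtain ⟨l, hl, hrow⟩ := exists_translation_row hN k i
    have : M ((l : ℕ) - (i : ℕ)) = M (-k) := periodic_congr hM (by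
      rw [← dvd_neg]; simpa [sub_eq_add_neg, add_comm, add_left_comm] using hl)
    rw [Matrix.trace_mul_comm, Matrix.trace]
    refine Finset.sum_congr rfl fun x _ => ?_
    rw [Matrix.mul_apply, Fintype.sum_prod_type, Finset.sum_eq_single l]
    · simp [hrow, circ_apply, this, Matrix.mul_apply]
    · intro j _ hj
      simp [hrow, hj]
    · simp
  rw [Matrix.trace, Fintype.sum_prod_type]
  simp only [Matrix.diag_apply, hrow]
  simp

lemma commute_translation (hN : 0 < N) (a b : ℤ) :
    Commute (translation N a) (translation N b) := by
  rw [Commute, SemiconjBy, translation_mul hN, translation_mul hN, add_comm]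

lemma exists_lag_scalarCoeffs (p : Fin (n + 1) → ℂ) (k : ℤ) :
    ∃ c : ℂ, lag (scalarCoeffs m p) k = c • (1 : Matrix (Fin m) (Fin m) ℂ) := by
  simp only [lag, scalarCoeffs]
  split_ifs with h
  · exact ⟨_, rfl⟩
  · exact ⟨_, by rw [Matrix.conjTranspose_smul, Matrix.conjTranspose_one]⟩
  · exact ⟨0, by simp⟩

/-- Translations commute with each other and scalar blocks commute with all blocks. The scalar form
of `P` enters the argument through this fact. -/
lemma commute_scalar_blockCirc (hN : 0 < N) (p : Fin (n + 1) → ℂ)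
    (M : ℤ → Matrix (Fin m) (Fin m) ℂ) :
    Commute (banded N (scalarCoeffs m p)) (blockCirc N M) := by
  rw [banded_eq_sum hN, blockCirc]
  refine Commute.sum_left _ _ _ fun k _ => Commute.sum_right _ _ _ fun l _ => ?_
  obtain ⟨c, hc⟩ := exists_lag_scalarCoeffs (m := m) p k
  rw [hc, shift_zpow hN, Commute, SemiconjBy, ← Matrix.mul_kronecker_mul,
    ← Matrix.mul_kronecker_mul, (commute_translation hN k l).eq]
  simp

lemma commute_scalar_banded (hN : 0 < N) (p : Fin (n + 1) → ℂ) (Q : Coeffs m n) :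
    Commute (banded N (scalarCoeffs m p)) (banded N Q) := by
  rw [banded_eq_circ hN Q, ← blockCirc_eq_circ hN (wrap_periodic Q)]
  exact commute_scalar_blockCirc hN p _

lemma commute_translation_banded (hN : 0 < N) (k : ℤ) (Q : Coeffs m n) :
    Commute (translation N k ⊗ₖ (1 : Matrix (Fin m) (Fin m) ℂ)) (banded N Q) := by
  rw [banded_eq_sum hN]
  refine Commute.sum_right _ _ _ fun l _ => ?_
  rw [Commute, SemiconjBy, ← Matrix.mul_kronecker_mul,
    ← Matrix.mul_kronecker_mul, (commute_translation hN k l).eq, Matrix.one_mul, Matrix.mul_one]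

lemma translation_kronecker_one_mul (hN : 0 < N) (A : BigMatrix m N) (k : ℤ)
    {i l : Fin (2 * N)} (h : (2 * N : ℤ) ∣ (i : ℕ) - (l : ℕ) - k) (x y : Fin m)
    (j : Fin (2 * N)) :
    (translation N k ⊗ₖ (1 : Matrix (Fin m) (Fin m) ℂ) * A) (i, x) (j, y) = A (l, x) (j, y) := by
  obtain ⟨l', hl', hrow⟩ := exists_translation_row hN k i
  have : l = l' := by
    have := hrow l
    rw [translation_apply, if_pos h] at this
    by_contra hne
    simp [hne] at this
  subst this
  rw [Matrix.mul_apply, Fintype.sum_prod_type, Finset.sum_eq_single l]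
  · simp [hrow, Matrix.one_apply]
  · intro j _ hj
    simp [hrow, hj]
  · simp

/-- A Hermitian matrix commuting with all block translations is block-circulant. -/
lemma exists_circ_of_commute (hN : 0 < N) {A : BigMatrix m N} (hA : A.IsHermitian)
    (hc : ∀ k, Commute (translation N k ⊗ₖ (1 : Matrix (Fin m) (Fin m) ℂ)) A) :
    ∃ M : ℤ → Matrix (Fin m) (Fin m) ℂ, IsHermitianLags N M ∧ A = circ N M := by
  have hinv : ∀ (k : ℤ) (i j i' j' : Fin (2 * N)) (x y : Fin m),
      (2 * N : ℤ) ∣ (i : ℕ) - (i' : ℕ) - k → (2 * N : ℤ) ∣ (j : ℕ) - (j' : ℕ) - k →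
      A (i, x) (j, y) = A (i', x) (j', y) := by
    intro k i j i' j' x y hi hj
    have e1 := translation_kronecker_one_mul hN A k hi x y j'
    rw [← e1, (hc k).eq]
    -- Right multiplication by a translation is the adjoint of left multiplication by its inverse,
    -- since `A` is Hermitian.
    have h2 : A * translation N k ⊗ₖ (1 : Matrix (Fin m) (Fin m) ℂ) =
        (translation N (-k) ⊗ₖ (1 : Matrix (Fin m) (Fin m) ℂ) * A)ᴴ := by
      have ht : (translation N (-k))ᴴ = translation N k := by
        ext a b
        rw [Matrix.conjTranspose_apply, translation_apply, translation_apply]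
        have : (2 * N : ℤ) ∣ (b : ℕ) - (a : ℕ) - -k ↔ (2 * N : ℤ) ∣ (a : ℕ) - (b : ℕ) - k := by
          rw [← dvd_neg]; ring_nf
        simp only [this]
        split_ifs <;> simp
      rw [Matrix.conjTranspose_mul, hA.eq, Matrix.conjTranspose_kronecker, ht,
        Matrix.conjTranspose_one]
    rw [h2, Matrix.conjTranspose_apply,
      translation_kronecker_one_mul hN A (-k) (l := j) (by
        rw [← dvd_neg]; simpa [sub_eq_add_neg, add_comm, add_left_comm] using hj), ← Matrix.conjTranspose_apply, hA.eq]
  choose res hres using exists_fin_dvd_iff hN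
  -- The lags are then read from a single block column, with `res z` the representative of z modulo
  -- 2N.
  have hres' : ∀ z : ℤ, (2 * N : ℤ) ∣ z - (res z : ℕ) := fun z => (hres z _).mpr rfl
  let M : ℤ → Matrix (Fin m) (Fin m) ℂ := fun z => Matrix.of fun x y => A (res z, x) (res 0, y)
  have hAM : A = circ N M := by
    ext ⟨i, x⟩ ⟨j, y⟩
    rw [circ_apply]
    have h1 := hres' ((i : ℕ) - (j : ℕ))
    have h2 := hres' 0
    refine hinv (j : ℕ) _ _ _ _ x y ?_ ?_
    · convert h1 using 1; ring
    · convert h2 using 1; ring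
  have hper : ∀ k, M (k + 2 * (N : ℤ)) = M k := by
    intro k
    have : res (k + 2 * (N : ℤ)) = res k := by
      rw [← hres k]
      have := (hres' (k + 2 * (N : ℤ)))
      rw [show k + 2 * (N : ℤ) - (res (k + 2 * (N : ℤ)) : ℕ) =
        k - (res (k + 2 * (N : ℤ)) : ℕ) + 2 * N by ring] at this
      exact dvd_add_self_right.mp this
    simp only [M, this]
  refine ⟨M, ⟨hper, fun k => ?_⟩, hAM⟩
  ext x y
  rw [Matrix.conjTranspose_apply]
  have h0 := hres' 0
  have hk := hres' k
  have hnk := hres' (-k)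
  simp only [M, Matrix.of_apply]
  rw [← Matrix.conjTranspose_apply, hA.eq]
  refine hinv (-k) _ _ _ _ x y ?_ ?_
  · rw [show ((res (-k) : ℕ) : ℤ) - (res 0 : ℕ) - -k =
      (0 - (res 0 : ℕ)) - (-k - (res (-k) : ℕ)) by ring]
    exact Int.dvd_sub h0 hnk
  · rw [show ((res 0 : ℕ) : ℤ) - (res k : ℕ) - -k =
      (k - (res k : ℕ)) - (0 - (res 0 : ℕ)) by ring]
    exact Int.dvd_sub hk h0

/-! ### Symbols at the 2N-th roots of unity. -/

lemma zeta_ne_zero (N : ℕ) (j : ℤ) : zeta N j ≠ 0 := Complex.exp_ne_zero _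

lemma zeta_zpow_eq (hN : 0 < N) (j : ℤ) {a b : ℤ} (h : (2 * N : ℤ) ∣ a - b) :
    zeta N j ^ a = zeta N j ^ b := by
  refine periodic_congr (N := N) (fun k => ?_) h
  rw [zpow_add₀ (zeta_ne_zero N j)]
  have : zeta N j ^ (2 * (N : ℤ)) = 1 := by
    rw [zeta, ← Complex.exp_int_mul, Complex.exp_eq_one_iff]
    refine ⟨j, ?_⟩
    have : (N : ℂ) ≠ 0 := by exact_mod_cast hN.ne'
    push_cast
    field_simp
  rw [this, mul_one]

lemma star_zeta_zpow (j k : ℤ) : star (zeta N j ^ k) = zeta N j ^ (-k) := by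
  have : star (zeta N j) = (zeta N j)⁻¹ := by
    rw [zeta, ← Complex.exp_neg, Complex.star_def, ← Complex.exp_conj]
    congr 1
    simp
  rw [star_zpow₀, this, inv_zpow, zpow_neg]

/-- A positive definite banded block-circulant matrix has a symbol that is positive definite at
the points of the discrete unit circle. -/
lemma mem_posCone_of_posDef (hnN : n < N) {Q : Coeffs m n} (hQ : (banded N Q).PosDef) :
    Q ∈ posCone m n N := by
  have hN : 0 < N := by omega
  refine ⟨isHermitian_zero_of_banded hnN hQ.isHermitian, fun j _ => ?_⟩
  -- The columns of `F` are the Fourier vectors of frequency ζ_j, one for each coordinate of the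
  -- block; compression by `F` turns a banded circulant matrix into 2N times its symbol.
  let F : Matrix (Fin (2 * N) × Fin m) (Fin m) ℂ :=
    Matrix.of fun x b => if x.2 = b then zeta N j ^ ((x.1 : ℕ) : ℤ) else 0
  have hF : Function.Injective F.mulVec := by
    intro v w h
    ext b
    have := congrFun h (⟨0, by omega⟩, b)
    simpa [F, Matrix.mulVec, dotProduct] using this
  have hFA : Fᴴ * banded N Q * F = (2 * N : ℂ) • symbol Q (zeta N j) := by
    rw [banded_eq_sum hN, Matrix.mul_sum, Matrix.sum_mul, symbol, Finset.smul_sum]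
    refine Finset.sum_congr rfl fun k _ => ?_
    generalize lag Q k = B
    have hBF : (translation N k ⊗ₖ B) * F =
        Matrix.of fun x b => zeta N j ^ (((x.1 : ℕ) : ℤ) - k) * B x.2 b := by
      ext ⟨i, x⟩ b
      obtain ⟨l, hl, hrow⟩ := exists_translation_row hN k i
      rw [Matrix.mul_apply, Fintype.sum_prod_type, Finset.sum_eq_single l]
      · simp only [Matrix.kroneckerMap_apply, hrow, if_true, one_mul, F, Matrix.of_apply, mul_ite,
          mul_zero, Finset.sum_ite_eq', Finset.mem_univ]
        rw [mul_comm, zeta_zpow_eq hN j (a := ((i : ℕ) : ℤ) - k) (b := (l : ℕ))]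
        convert hl using 1; ring
      · intro l' _ hl'
        simp [hrow, hl']
      · simp
    rw [Matrix.mul_assoc, hBF]
    ext a b
    rw [Matrix.mul_apply, Fintype.sum_prod_type]
    have hterm : ∀ i : Fin (2 * N), ∑ x, Fᴴ a (i, x) *
        (Matrix.of fun (x : Fin (2 * N) × Fin m) b => zeta N j ^ (((x.1 : ℕ) : ℤ) - k) * B x.2 b)
          (i, x) b = zeta N j ^ (-k) * B a b := by
      intro i
      rw [Finset.sum_eq_single a]
      · simp only [F, Matrix.conjTranspose_apply, Matrix.of_apply, if_true, star_zeta_zpow]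
        rw [← mul_assoc, ← zpow_add₀ (zeta_ne_zero N j)]
        congr 2; ring
      · intro x _ hx
        simp [F, hx]
      · simp
    simp only [hterm]
    simp
  have h := hQ.conjTranspose_mul_mul_same hF
  rw [hFA] at h
  have h2 : (0 : ℂ) < (2 * N : ℂ)⁻¹ := by
    have : (0 : ℝ) < (2 * N : ℝ)⁻¹ := by positivity
    have := Complex.zero_lt_real.mpr this
    push_cast at this
    exact this
  have h3 := h.smul h2
  rwa [smul_smul, inv_mul_cancel₀ (by
    have : (N : ℂ) ≠ 0 := by exact_mod_cast hN.ne'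
    simpa using this), one_smul] at h3

end BlockCirculant

end

/-! ### Compactness and coercivity from the dual cone. -/

lemma Matrix.isClosed_posSemidef {ι : Type*} [Fintype ι] :
    IsClosed {A : Matrix ι ι ℂ | A.PosSemidef} := by
  simp only [Matrix.posSemidef_iff_dotProduct_mulVec, Set.ofPred_and, Set.ofPred_forall]
  refine IsClosed.inter ?_ (isClosed_iInter fun x => ?_)
  · exact isClosed_eq (continuous_id.matrix_conjTranspose) continuous_id
  · refine isClosed_le continuous_const ?_
    exact continuous_const.dotProduct (continuous_id.matrix_mulVec continuous_const)

noncomputable section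

namespace BlockCirculant

variable {m n N : ℕ}

/-- The coefficients of the identity matrix. -/
def oneCoeffs (m n : ℕ) : Coeffs m n := fun k => if k = 0 then 1 else 0

lemma lag_oneCoeffs (k : ℤ) : lag (oneCoeffs m n) k = if k = 0 then 1 else 0 := by
  by_cases hk : k = 0
  · subst hk; simp [lag_zero, oneCoeffs]
  · have : ∀ h : k.natAbs < n + 1, (⟨k.natAbs, h⟩ : Fin (n + 1)) ≠ 0 := fun h h0 => hk (by
      simpa using congrArg Fin.val h0)
    simp only [lag, oneCoeffs, hk, if_false]
    split_ifs <;> simp_all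

lemma banded_oneCoeffs (hN : 0 < N) : banded N (oneCoeffs m n) = 1 := by
  rw [banded_eq_sum hN, Finset.sum_eq_single 0]
  · simp [lag_oneCoeffs, translation_zero]
  · intro k _ hk
    simp [lag_oneCoeffs, hk]
  · simp

/-- Adding s times the identity, s ↓ 0, approaches `Q` from inside the cone. Semidefinite limits
must be covered, since the minimum over a compact slice may lie on the boundary. -/
lemma mem_closure_posCone (hnN : n < N) {Q : Coeffs m n} (hQ : (banded N Q).PosSemidef) :
    Q ∈ closure (posCone m n N) := by
  have hN : 0 < N := by omega
  have hlim : Filter.Tendsto (fun s : ℝ => Q + s • oneCoeffs m n) (nhdsWithin 0 (Set.Ioi 0))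
      (nhds Q) := by
    have : Continuous fun s : ℝ => Q + s • oneCoeffs m n := by fun_prop
    have h := (this.tendsto 0).mono_left (nhdsWithin_le_nhds (s := Set.Ioi 0))
    simpa using h
  refine mem_closure_of_tendsto hlim (Filter.eventually_of_mem self_mem_nhdsWithin fun s hs => ?_)
  apply mem_posCone_of_posDef hnN
  rw [banded_add, banded_smul, banded_oneCoeffs hN]
  exact Matrix.PosDef.posSemidef_add hQ (Matrix.PosDef.one.smul hs)

lemma trace_banded_mul_banded (hnN : n < N) {C : Coeffs m n} (hC : (C 0).IsHermitian)
    (Q : Coeffs m n) : (banded N C * banded N Q).trace.re = 2 * N * pairing C Q := by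
  have hN : 0 < N := by omega
  rw [banded_eq_circ hN C, trace_circ_mul_banded hN (wrap_periodic C), pairing,
    show (2 * N : ℂ) = ((2 * N : ℝ) : ℂ) by push_cast; rfl, Complex.re_ofReal_mul, Complex.re_sum,
    Complex.re_sum]
  congr 1
  refine Finset.sum_congr rfl fun k hk => ?_
  rw [wrap_neg hC, wrap_eq_lag hnN C hk, ← Complex.conj_re, ← Complex.star_def,
    ← Matrix.trace_conjTranspose, Matrix.conjTranspose_mul, Matrix.conjTranspose_conjTranspose,
    Matrix.trace_mul_comm]

/-- The trace bounds all entries of a positive semidefinite matrix, and the coefficients are among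
these entries. -/
lemma isCompact_setOf_posSemidef (hnN : n < N) (δ τ : ℝ) (hδ : 0 ≤ δ) :
    IsCompact {Q : Coeffs m n | (banded N Q - (δ : ℂ) • (1 : BigMatrix m N)).PosSemidef ∧
      (banded N Q).trace.re ≤ τ} := by
  have hcont : Continuous (banded N : Coeffs m n → BigMatrix m N) := continuous_banded
  have hbox : IsCompact (Set.pi Set.univ fun _ : Fin (n + 1) => Set.pi Set.univ fun _ : Fin m =>
      Set.pi Set.univ fun _ : Fin m => Metric.closedBall (0 : ℂ) τ) :=
    isCompact_univ_pi fun _ => isCompact_univ_pi fun _ => isCompact_univ_pi fun _ =>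
      isCompact_closedBall _ _
  refine IsCompact.of_isClosed_subset hbox ?_ ?_
  · refine IsClosed.inter (Matrix.isClosed_posSemidef.preimage (hcont.sub continuous_const)) ?_
    exact isClosed_le (Complex.continuous_re.comp hcont.matrix_trace) continuous_const
  · rintro Q ⟨h1, h2⟩ k _ x _ y _
    have h3 : (banded N Q).PosSemidef := by
      have : ((δ : ℂ) • (1 : BigMatrix m N)).PosSemidef :=
        Matrix.PosSemidef.one.smul (by simpa using hδ)
      simpa using h1.add this
    rw [mem_closedBall_zero_iff, ← banded_block hnN Q k x y]
    exact (h3.norm_apply_le_trace _ _).trans h2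

/-- Elements of the dual cone are coercive on positive definite banded matrices. -/
lemma exists_trace_le_trace_mul (hnN : n < N) {C : Coeffs m n} (hC : C ∈ dualCone m n N) :
    ∃ c : ℝ, 0 < c ∧ ∀ Q : Coeffs m n, (banded N Q).PosDef →
      c * (banded N Q).trace.re ≤ (banded N C * banded N Q).trace.re := by
  have hN : 0 < N := by omega
  have hcont : Continuous (banded N : Coeffs m n → BigMatrix m N) := continuous_banded
  -- By homogeneity it suffices to bound tr(CQ) below on the trace-one slice, which is compact.
  set K := {Q : Coeffs m n | (banded N Q - ((0 : ℝ) : ℂ) • (1 : BigMatrix m N)).PosSemidef ∧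
      (banded N Q).trace.re ≤ 1} ∩ {Q | (banded N Q).trace.re = 1} with hK
  have hKc : IsCompact K := (isCompact_setOf_posSemidef hnN 0 1 le_rfl).inter_right
    (isClosed_eq (Complex.continuous_re.comp hcont.matrix_trace) continuous_const)
  have hpos : ∀ Q ∈ K, 0 < (banded N C * banded N Q).trace.re := by
    rintro Q ⟨⟨h1, -⟩, h2⟩
    rw [trace_banded_mul_banded hnN hC.1]
    have h0 : Q ≠ 0 := by
      rintro rfl
      have : banded N (0 : Coeffs m n) = 0 := (bandedLinear m n N).map_zero
      simp [this] at h2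
    have := hC.2 Q (mem_closure_posCone hnN (by simpa using h1)) h0
    positivity
  obtain ⟨c, hc, hcK⟩ : ∃ c : ℝ, 0 < c ∧ ∀ Q ∈ K, c ≤ (banded N C * banded N Q).trace.re := by
    rcases K.eq_empty_or_nonempty with h | h
    · exact ⟨1, one_pos, by simp [h]⟩
    · obtain ⟨Q, hQ, hmin⟩ := hKc.exists_isMinOn h (f := fun Q => (banded N C * banded N Q).trace.re)
        (Complex.continuous_re.comp (continuous_const.matrix_mul hcont).matrix_trace).continuousOn
      exact ⟨_, hpos Q hQ, fun Q' hQ' => hmin hQ'⟩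
  refine ⟨c, hc, fun Q hQ => ?_⟩
  -- Trace zero occurs here only for empty blocks, m = 0; otherwise `Q` is rescaled into the slice.
  rcases (Complex.le_def.mp hQ.posSemidef.trace_nonneg).1.eq_or_lt with h | h
  · have : banded N Q = 0 := by
      rw [← hQ.posSemidef.trace_eq_zero_iff]
      exact Complex.ext h.symm (Complex.le_def.mp hQ.posSemidef.trace_nonneg).2.symm
    simp [this]
  · set t := (banded N Q).trace.re
    have ht : 0 < t := h
    have h1 : (banded N (t⁻¹ • Q)).trace.re = 1 := by
      rw [banded_smul, Matrix.trace_smul, Complex.smul_re, smul_eq_mul]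
      exact inv_mul_cancel₀ ht.ne'
    have hmem : t⁻¹ • Q ∈ K := by
      refine ⟨⟨?_, h1.le⟩, h1⟩
      rw [Complex.ofReal_zero, zero_smul, sub_zero, banded_smul]
      exact hQ.posSemidef.smul (inv_pos.mpr ht).le
    have h2 := hcK _ hmem
    rw [banded_smul, Matrix.mul_smul, Matrix.trace_smul, Complex.smul_re, smul_eq_mul] at h2
    rwa [le_inv_mul_iff₀ ht, mul_comm] at h2

lemma trace_mul_re_le {ι : Type*} [Fintype ι] [DecidableEq ι] (P : Matrix ι ι ℂ)
    {A : Matrix ι ι ℂ} (hA : A.PosSemidef) :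
    (P * A).trace.re ≤ (∑ i, ∑ j, ‖P i j‖) * A.trace.re := by
  refine (Complex.re_le_norm _).trans ?_
  rw [Matrix.trace, Finset.sum_mul]
  refine (norm_sum_le _ _).trans (Finset.sum_le_sum fun i _ => ?_)
  rw [Matrix.diag_apply, Matrix.mul_apply, Finset.sum_mul]
  refine (norm_sum_le _ _).trans (Finset.sum_le_sum fun j _ => ?_)
  rw [norm_mul]
  exact mul_le_mul_of_nonneg_left (hA.norm_apply_le_trace _ _) (norm_nonneg _)

/-! ### Existence of a dual minimizer. -/

/-- Sublevel sets of the dual functional are bounded and stay away from the singular matrices. -/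
lemma exists_sublevel_bounds (hnN : n < N) {C : Coeffs m n} (hC : C ∈ dualCone m n N)
    {P : BigMatrix m N} (hP : P.PosDef) (J₀ : ℝ) :
    ∃ δ τ : ℝ, 0 < δ ∧ ∀ Q : Coeffs m n, (banded N Q).PosDef →
      dual (banded N C) P (banded N Q) ≤ J₀ →
      (banded N Q - (δ : ℂ) • (1 : BigMatrix m N)).PosSemidef ∧ (banded N Q).trace.re ≤ τ := by
  obtain ⟨c, hc, hcQ⟩ := exists_trace_le_trace_mul hnN hC
  obtain ⟨ε, hε, hPε⟩ := hP.exists_posSemidef_sub_smul_one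
  set S := ∑ i, ∑ j, ‖P i j‖
  have hS0 : 0 ≤ S := by positivity
  -- Chosen so that S / t ≤ c / 2: the tangent at t · 1 then consumes at most half of the coercive
  -- term c · tr A. The summand 1 keeps t positive when S = 0.
  set t : ℝ := 2 * (S + 1) / c with ht
  have ht0 : 0 < t := by positivity
  set X : BigMatrix m N := (t : ℂ) • 1 with hX
  have hXpos : X.PosDef := Matrix.PosDef.one.smul (by simpa using ht0)
  have hXinv : X⁻¹ = ((t⁻¹ : ℝ) : ℂ) • (1 : BigMatrix m N) := by
    apply Matrix.inv_eq_right_inv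
    rw [hX, Matrix.smul_mul, Matrix.one_mul, smul_smul, ← Complex.ofReal_mul,
      mul_inv_cancel₀ ht0.ne', Complex.ofReal_one, one_smul]
  have hXc : Commute P X := by
    rw [hX, Commute, SemiconjBy, Matrix.mul_smul, Matrix.smul_mul, Matrix.mul_one, Matrix.one_mul]
  set c₁ := (P * cfc Real.log X).trace.re - (P * X⁻¹ * X).trace.re
  -- Solves (c/2) tr A − c₁ ≤ J₀ for tr A.
  set τ := 2 * (J₀ + c₁) / c with hτ
  -- Solves −J₀ ≤ ε (log y − log τ) + log τ · tr P for log y; the left side is a lower bound for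
  -- tr(P log A) because tr(CA) ≥ 0.
  set L := Real.log τ + (-J₀ - Real.log τ * P.trace.re) / ε with hL
  refine ⟨Real.exp L, τ, Real.exp_pos _, fun Q hQ hJ => ?_⟩
  have h1 := hcQ Q hQ
  set A := banded N Q
  have htr0 : 0 ≤ A.trace.re := (Complex.le_def.mp hQ.posSemidef.trace_nonneg).1
  rw [dual, matrixLog] at hJ
  have h2 := hP.trace_mul_log_le hXpos hQ hXc
  have h3 : (P * X⁻¹ * (A - X)).trace.re = t⁻¹ * (P * A).trace.re - (P * X⁻¹ * X).trace.re := by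
    rw [Matrix.mul_sub, Matrix.trace_sub, Complex.sub_re]
    congr 1
    rw [hXinv, Matrix.mul_smul, Matrix.mul_one, Matrix.smul_mul, Matrix.trace_smul, smul_eq_mul,
      Complex.re_ofReal_mul]
  have h4 : t⁻¹ * (P * A).trace.re ≤ c / 2 * A.trace.re := by
    calc t⁻¹ * (P * A).trace.re ≤ t⁻¹ * (S * A.trace.re) := by
          gcongr; exact trace_mul_re_le P hQ.posSemidef
      _ = (t⁻¹ * S) * A.trace.re := by ring
      _ ≤ c / 2 * A.trace.re := by
          gcongr
          rw [ht, inv_div, div_mul_eq_mul_div, div_le_div_iff₀ (by positivity) (by positivity)]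
          nlinarith
  have hbound : A.trace.re ≤ τ := by
    rw [hτ, le_div_iff₀ hc]
    linarith
  refine ⟨hQ.isHermitian.posSemidef_sub_smul_one fun i => ?_, hbound⟩
  have h5 := hP.mul_log_eigenvalue_ge hQ hPε hbound i
  rw [← Real.le_log_iff_exp_le (hQ.eigenvalues_pos i), hL]
  have h6 : (-J₀ - Real.log τ * P.trace.re) / ε ≤
      Real.log (hQ.isHermitian.eigenvalues i) - Real.log τ := by
    rw [div_le_iff₀ hε]
    have : 0 ≤ c * A.trace.re := by positivity
    linarith
  linarith

lemma exists_minimizer (hnN : n < N) {C : Coeffs m n} (hC : C ∈ dualCone m n N)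
    {p : Fin (n + 1) → ℂ} (hP : (banded N (scalarCoeffs m p)).PosDef) :
    ∃ Q : Coeffs m n, (banded N Q).PosDef ∧ ∀ Q' : Coeffs m n, (banded N Q').PosDef →
      dual (banded N C) (banded N (scalarCoeffs m p)) (banded N Q) ≤
        dual (banded N C) (banded N (scalarCoeffs m p)) (banded N Q') := by
  have hN : 0 < N := by omega
  have hcont : Continuous (banded N : Coeffs m n → BigMatrix m N) := continuous_banded
  have hE : (banded N (oneCoeffs m n)).PosDef := by
    rw [banded_oneCoeffs hN]; exact Matrix.PosDef.one
  set P := banded N (scalarCoeffs m p)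
  let J : Coeffs m n → ℝ := fun Q => dual (banded N C) P (banded N Q)
  obtain ⟨δ, τ, hδ, hsub⟩ := exists_sublevel_bounds hnN hC hP (J (oneCoeffs m n))
  have hK := isCompact_setOf_posSemidef (m := m) hnN δ τ hδ.le
  set K := {Q : Coeffs m n | (banded N Q - (δ : ℂ) • (1 : BigMatrix m N)).PosSemidef ∧
      (banded N Q).trace.re ≤ τ}
  have hKpos : ∀ Q ∈ K, (banded N Q).PosDef := fun Q hQ => hQ.1.posDef_of_sub_smul_one hδ
  have hEK : oneCoeffs m n ∈ K := hsub _ hE le_rfl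
  have hlsc : LowerSemicontinuousOn J K := by
    intro Q hQ y hy
    -- A continuous minorant of `J` on `K` that touches it at `Q`, obtained from the tangent to tr(P
    -- log ·) there.
    let g : Coeffs m n → ℝ := fun Q' => (banded N C * banded N Q').trace.re -
      ((P * cfc Real.log (banded N Q)).trace.re +
        (P * (banded N Q)⁻¹ * (banded N Q' - banded N Q)).trace.re)
    have hg : Continuous g := by
      refine Continuous.sub ?_ (continuous_const.add ?_)
      · exact Complex.continuous_re.comp (continuous_const.matrix_mul hcont).matrix_trace
      · exact Complex.continuous_re.comp
          (continuous_const.matrix_mul (hcont.sub continuous_const)).matrix_trace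
    have hgQ : g Q = J Q := by simp [g, J, dual, matrixLog]
    have hev : ∀ᶠ Q' in nhdsWithin Q K, y < g Q' :=
      (hg.continuousWithinAt).eventually_const_lt (by rw [hgQ]; exact hy)
    filter_upwards [hev, self_mem_nhdsWithin] with Q' h1 h2
    refine h1.trans_le ?_
    have := hP.trace_mul_log_le (hKpos Q hQ) (hKpos Q' h2) (commute_scalar_banded hN p Q)
    simp only [g, J, dual, matrixLog]
    linarith
  obtain ⟨Q, hQ, hmin⟩ := hlsc.exists_isMinOn ⟨_, hEK⟩ hK
  refine ⟨Q, hKpos Q hQ, fun Q' hQ' => ?_⟩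
  by_cases h : J Q' ≤ J (oneCoeffs m n)
  · exact hmin (hsub Q' hQ' h)
  · exact (hmin hEK).trans (not_le.mp h).le

/-- If A ≥ ε and H ≥ κ, with κ possibly negative, then A + sH ≥ ε + sκ, which is positive for small
s > 0. -/
lemma eventually_posDef_add_smul {A H : BigMatrix m N} (hA : A.PosDef) (hH : H.IsHermitian) :
    ∀ᶠ s : ℝ in nhdsWithin 0 (Set.Ioi 0), (A + s • H).PosDef := by
  obtain ⟨ε, hε, hAε⟩ := hA.exists_posSemidef_sub_smul_one
  obtain ⟨κ, hκ⟩ : ∃ κ : ℝ, (H - (κ : ℂ) • (1 : BigMatrix m N)).PosSemidef := by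
    obtain ⟨κ, hκ⟩ := (Set.finite_range hH.eigenvalues).bddBelow
    exact ⟨κ, hH.posSemidef_sub_smul_one fun i => hκ ⟨i, rfl⟩⟩
  have hlim : ∀ᶠ s : ℝ in nhdsWithin 0 (Set.Ioi 0), 0 < ε + s * κ := by
    have : Continuous fun s : ℝ => ε + s * κ := by fun_prop
    exact (this.continuousWithinAt (s := Set.Ioi 0) (x := 0)).eventually_const_lt (by simpa using hε)
  filter_upwards [hlim, self_mem_nhdsWithin] with s hs (hs0 : 0 < s)
  have h1 : (((ε + s * κ : ℝ) : ℂ) • (1 : BigMatrix m N)).PosDef :=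
    Matrix.PosDef.one.smul (by simpa using Complex.zero_lt_real.mpr hs)
  have h2 := (h1.add_posSemidef hAε).add_posSemidef (hκ.smul hs0.le)
  convert h2 using 1
  rw [smul_sub, ← Complex.coe_smul s, ← Complex.coe_smul s, smul_smul]
  push_cast
  module

/-! ### Stationarity and matching of the prescribed lags. -/

/-- First-order condition at a minimizer of the dual functional. -/
lemma trace_le_of_isMin (hnN : n < N) {C : Coeffs m n}
    {p : Fin (n + 1) → ℂ} (hP : (banded N (scalarCoeffs m p)).PosDef)
    {Q : Coeffs m n} (hQ : (banded N Q).PosDef)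
    (hmin : ∀ Q' : Coeffs m n, (banded N Q').PosDef →
      dual (banded N C) (banded N (scalarCoeffs m p)) (banded N Q) ≤
        dual (banded N C) (banded N (scalarCoeffs m p)) (banded N Q'))
    {H : Coeffs m n} (hH : (H 0).IsHermitian) :
    (banded N (scalarCoeffs m p) * (banded N Q)⁻¹ * banded N H).trace.re ≤
      (banded N C * banded N H).trace.re := by
  have hN : 0 < N := by omega
  set P := banded N (scalarCoeffs m p)
  have hHh : (banded N H).IsHermitian := by
    rw [banded_eq_circ hN]; exact circ_isHermitian (wrap_neg hH)
  -- The tangent is taken at the perturbed point and evaluated at `Q`. Combined with minimality this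
  -- gives the inequality times s; dividing by s > 0 and letting s → 0 needs only continuity of the
  -- inverse.
  have hev : ∀ᶠ s : ℝ in nhdsWithin 0 (Set.Ioi 0),
      (P * (banded N Q + s • banded N H)⁻¹ * banded N H).trace.re ≤
        (banded N C * banded N H).trace.re := by
    filter_upwards [eventually_posDef_add_smul hQ hHh, self_mem_nhdsWithin] with s hs (hs0 : 0 < s)
    have hb : banded N (Q + s • H) = banded N Q + s • banded N H := by
      rw [banded_add, banded_smul]
    have h1 := hmin (Q + s • H) (by rw [hb]; exact hs)
    have h2 := hP.trace_mul_log_le hs hQ (by rw [← hb]; exact commute_scalar_banded hN p _)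
    rw [hb] at h1
    simp only [dual, matrixLog] at h1
    rw [Matrix.mul_add, Matrix.trace_add, Complex.add_re, Matrix.mul_smul, Matrix.trace_smul,
      Complex.smul_re, smul_eq_mul] at h1
    rw [sub_add_cancel_left, Matrix.mul_neg, Matrix.trace_neg, Complex.neg_re, Matrix.mul_smul,
      Matrix.trace_smul, Complex.smul_re, smul_eq_mul] at h2
    nlinarith
  refine le_of_tendsto ?_ hev
  have hinv : Filter.Tendsto (fun s : ℝ => (banded N Q + s • banded N H)⁻¹)
      (nhdsWithin 0 (Set.Ioi 0)) (nhds (banded N Q)⁻¹) := by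
    have hc : Continuous fun s : ℝ => banded N Q + s • banded N H := by fun_prop
    have hdet : (banded N Q).det ≠ 0 := ((Matrix.isUnit_iff_isUnit_det _).mp hQ.isUnit).ne_zero
    have h0 : banded N Q + (0 : ℝ) • banded N H = banded N Q := by simp
    have hca : ContinuousAt (fun s : ℝ => (banded N Q + s • banded N H)⁻¹) 0 := by
      simp only [Matrix.inv_def, Ring.inverse_eq_inv']
      refine ContinuousAt.smul (ContinuousAt.inv₀ hc.matrix_det.continuousAt ?_)
        hc.matrix_adjugate.continuousAt
      rwa [h0]
    have := hca.tendsto.mono_left (nhdsWithin_le_nhds (s := Set.Ioi 0))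
    rwa [h0] at this
  have hφ : Continuous fun Z : BigMatrix m N => (P * Z * banded N H).trace.re :=
    Complex.continuous_re.comp
      ((continuous_const.matrix_mul continuous_id).matrix_mul continuous_const).matrix_trace
  exact (hφ.tendsto _).comp hinv

/-- `Q⁻¹ P` is block-circulant when `Q` is banded block-circulant and `P` is scalar banded. -/
lemma exists_circ_inv_mul (hN : 0 < N) {p : Fin (n + 1) → ℂ}
    (hP : (banded N (scalarCoeffs m p)).PosDef) {Q : Coeffs m n} (hQ : (banded N Q).PosDef) :
    ∃ M : ℤ → Matrix (Fin m) (Fin m) ℂ, IsHermitianLags N M ∧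
      (banded N Q)⁻¹ * banded N (scalarCoeffs m p) = circ N M := by
  refine exists_circ_of_commute hN
    (hP.inv_mul_of_commute hQ (commute_scalar_banded hN p Q)).isHermitian fun k => ?_
  exact (hQ.commute_inv_right (commute_translation_banded hN k Q)).mul_right
    (commute_translation_banded hN k _)

lemma isExtension_of_isMin (hnN : n < N) {C : Coeffs m n} (hC : (C 0).IsHermitian)
    {p : Fin (n + 1) → ℂ} (hP : (banded N (scalarCoeffs m p)).PosDef)
    {Q : Coeffs m n} (hQ : (banded N Q).PosDef)
    (hmin : ∀ Q' : Coeffs m n, (banded N Q').PosDef →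
      dual (banded N C) (banded N (scalarCoeffs m p)) (banded N Q) ≤
        dual (banded N C) (banded N (scalarCoeffs m p)) (banded N Q')) :
    IsExtension C ((banded N Q)⁻¹ * banded N (scalarCoeffs m p)) := by
  have hN : 0 < N := by omega
  obtain ⟨M, hM, hMe⟩ := exists_circ_inv_mul hN hP hQ
  have hcomm := hQ.commute_inv_right (commute_scalar_banded hN p Q)
  let D : ℤ → Matrix (Fin m) (Fin m) ℂ := fun k => wrap N C k - M k
  have hDper : ∀ k, D (k + 2 * (N : ℤ)) = D k := fun k => by
    simp only [D, wrap_periodic, hM.1]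
  have hDneg : ∀ k, D (-k) = (D k)ᴴ := fun k => by
    simp only [D, wrap_neg hC, hM.2, Matrix.conjTranspose_sub]
  have hDc : circ N D = banded N C - circ N M := by
    rw [banded_eq_circ hN]; rfl
  -- The test direction is the band of the defect `D` itself; using both `H` and `-H` turns the
  -- one-sided conditions into an orthogonality that reads ∑ tr(D_kᴴ D_k) = 0.
  let H : Coeffs m n := fun k => D ((k : ℕ) : ℤ)
  have hH : (H 0).IsHermitian := by
    have := hDneg 0
    rw [neg_zero] at this
    exact this.symm
  have hlag : ∀ k ∈ Finset.Icc (-(n : ℤ)) n, D k = lag H k :=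
    fun k hk => eq_lag_of_natCast hH hDneg (fun _ => rfl) hk
  have hle := trace_le_of_isMin hnN hP hQ hmin hH
  have hge := trace_le_of_isMin hnN hP hQ hmin (H := -H) (by simpa using hH.neg)
  have hneg : banded N (-H) = -banded N H := (bandedLinear m n N).map_neg H
  rw [hneg, Matrix.mul_neg, Matrix.mul_neg, Matrix.trace_neg, Matrix.trace_neg, Complex.neg_re,
    Complex.neg_re] at hge
  rw [hcomm.eq, hMe] at hle hge
  have hzero : (circ N D * banded N H).trace.re = 0 := by
    rw [hDc, Matrix.sub_mul, Matrix.trace_sub, Complex.sub_re]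
    linarith
  rw [trace_circ_mul_banded hN hDper] at hzero
  have hterm : ∀ k ∈ Finset.Icc (-(n : ℤ)) n,
      (D (-k) * lag H k).trace = ((D k)ᴴ * D k).trace := fun k hk => by
    rw [hDneg, ← hlag k hk]
  rw [Finset.sum_congr rfl hterm] at hzero
  have hnn : ∀ k, 0 ≤ ((D k)ᴴ * D k).trace := fun k =>
    (Matrix.posSemidef_conjTranspose_mul_self (D k)).trace_nonneg
  have hsum : ∑ k ∈ Finset.Icc (-(n : ℤ)) n, ((D k)ᴴ * D k).trace.re = 0 := by
    rw [← Complex.re_sum]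
    rw [show (2 * N : ℂ) = ((2 * N : ℝ) : ℂ) by push_cast; rfl, Complex.re_ofReal_mul] at hzero
    have : (2 * N : ℝ) ≠ 0 := by positivity
    exact (mul_eq_zero.mp hzero).resolve_left this
  rw [Finset.sum_eq_zero_iff_of_nonneg fun k _ => (Complex.le_def.mp (hnn k)).1] at hsum
  refine ⟨M, hM, fun k => ?_, by rw [hMe, blockCirc_eq_circ hN hM.1]⟩
  have hk : ((k : ℕ) : ℤ) ∈ Finset.Icc (-(n : ℤ)) n := by rw [Finset.mem_Icc]; omega
  have hDk : D ((k : ℕ) : ℤ) = 0 := by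
    rw [← Matrix.trace_conjTranspose_mul_self_eq_zero_iff]
    exact Complex.ext (hsum _ hk) (Complex.le_def.mp (hnn _)).2.symm
  have := sub_eq_zero.mp hDk
  rw [← this, wrap_eq_lag hnN C hk, lag_natCast]

/-! ### Strict optimality of the extension, primal and dual. -/

/-- Pairing with banded matrices only sees the lags `-n, …, n`. -/
lemma trace_circ_mul_banded_congr (hN : 0 < N) {M M' : ℤ → Matrix (Fin m) (Fin m) ℂ}
    (hM : ∀ k, M (k + 2 * (N : ℤ)) = M k) (hM' : ∀ k, M' (k + 2 * (N : ℤ)) = M' k)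
    (h : ∀ k ∈ Finset.Icc (-(n : ℤ)) n, M k = M' k) (H : Coeffs m n) :
    (circ N M * banded N H).trace = (circ N M' * banded N H).trace := by
  rw [trace_circ_mul_banded hN hM, trace_circ_mul_banded hN hM']
  congr 1
  refine Finset.sum_congr rfl fun k hk => ?_
  rw [h (-k) (by rw [Finset.mem_Icc] at *; omega)]

lemma trace_mul_banded_of_isExtension (hnN : n < N) {C : Coeffs m n} (hC : (C 0).IsHermitian)
    {A : BigMatrix m N} (hA : IsExtension C A) (H : Coeffs m n) :
    (A * banded N H).trace = (banded N C * banded N H).trace := by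
  have hN : 0 < N := by omega
  obtain ⟨M, hM, hMC, rfl⟩ := hA
  rw [blockCirc_eq_circ hN hM.1, banded_eq_circ hN C]
  refine trace_circ_mul_banded_congr hN hM.1 (wrap_periodic C) (fun k hk => ?_) H
  rw [wrap_eq_lag hnN C hk, eq_lag_of_natCast hC hM.2 hMC hk]

lemma embed_transpose_mul_circ_mul_embed (hnN : n < N) (M : ℤ → Matrix (Fin m) (Fin m) ℂ)
    (i j : Fin (n + 1)) (x y : Fin m) :
    ((embed m n N)ᵀ * circ N M * embed m n N) (i, x) (j, y) =
      M (((i : ℕ) : ℤ) - ((j : ℕ) : ℤ)) x y := by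
  have hrow : ∀ (k : Fin (n + 1)) (z : Fin m) (w : Fin (2 * N) × Fin m),
      embed m n N w (k, z) = if w = (⟨k, by omega⟩, z) then 1 else 0 := by
    rintro k z ⟨a, b⟩
    simp only [embed, Matrix.of_apply, Prod.mk.injEq, Fin.ext_iff]
  simp only [Matrix.mul_apply, Matrix.transpose_apply, hrow, ite_mul, one_mul, zero_mul, mul_ite,
    mul_one, mul_zero, Finset.sum_ite_eq', Finset.mem_univ, if_true]
  rfl

/-- The feasible set of the primal problem consists of the positive definite extensions. -/
lemma mem_primalSet_iff (hnN : n < N) {C : Coeffs m n} (hC : (C 0).IsHermitian)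
    {A : BigMatrix m N} : A ∈ primalSet N C ↔ A.PosDef ∧ IsExtension C A := by
  have hN : 0 < N := by omega
  constructor
  · rintro ⟨hA, ⟨M, hM, rfl⟩, hT⟩
    refine ⟨hA, M, hM, fun k => ?_, rfl⟩
    ext x y
    have := congrFun (congrFun hT (k, x)) (0, y)
    rw [blockCirc_eq_circ hN hM.1, embed_transpose_mul_circ_mul_embed hnN] at this
    simpa [toeplitz, lag_natCast] using this
  · rintro ⟨hA, M, hM, hMC, rfl⟩
    refine ⟨hA, ⟨M, hM, rfl⟩, ?_⟩
    ext ⟨i, x⟩ ⟨j, y⟩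
    rw [blockCirc_eq_circ hN hM.1, embed_transpose_mul_circ_mul_embed hnN,
      eq_lag_of_natCast hC hM.2 hMC (by rw [Finset.mem_Icc]; omega)]
    rfl

/-- The slope of tr(P log ·) at `Q` is Q⁻¹P, which pairs with banded differences exactly as `C`
does, so the linear terms cancel and the strict tangent inequality remains. -/
lemma dual_lt_of_isExtension (hnN : n < N) {C : Coeffs m n} (hC : (C 0).IsHermitian)
    {p : Fin (n + 1) → ℂ} (hP : (banded N (scalarCoeffs m p)).PosDef)
    {Q : Coeffs m n} (hQ : (banded N Q).PosDef)
    (hext : IsExtension C ((banded N Q)⁻¹ * banded N (scalarCoeffs m p)))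
    {A : BigMatrix m N} (hA : A ∈ dualSet m n N) (hne : A ≠ banded N Q) :
    dual (banded N C) (banded N (scalarCoeffs m p)) (banded N Q) <
      dual (banded N C) (banded N (scalarCoeffs m p)) A := by
  have hN : 0 < N := by omega
  obtain ⟨hApos, Q', rfl⟩ := hA
  have hcomm := commute_scalar_banded hN p Q
  have h := hP.trace_mul_log_lt hQ hApos hcomm hne
  rw [(hQ.commute_inv_right hcomm).eq, ← banded_sub, trace_mul_banded_of_isExtension hnN hC hext,
    banded_sub, Matrix.mul_sub, Matrix.trace_sub, Complex.sub_re] at h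
  simp only [dual, matrixLog]
  linarith

/-- At X = Q⁻¹P the slope P X⁻¹ is `Q`. Both competitors extend `C`, so their traces against the
banded `Q` coincide and the linear term vanishes. -/
lemma primal_lt_of_isExtension (hnN : n < N) {C : Coeffs m n} (hC : (C 0).IsHermitian)
    {p : Fin (n + 1) → ℂ} (hP : (banded N (scalarCoeffs m p)).PosDef)
    {Q : Coeffs m n} (hQ : (banded N Q).PosDef)
    (hext : IsExtension C ((banded N Q)⁻¹ * banded N (scalarCoeffs m p)))
    {Sig : BigMatrix m N} (hSig : Sig ∈ primalSet N C)
    (hne : Sig ≠ (banded N Q)⁻¹ * banded N (scalarCoeffs m p)) :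
    primal (banded N (scalarCoeffs m p)) Sig <
      primal (banded N (scalarCoeffs m p)) ((banded N Q)⁻¹ * banded N (scalarCoeffs m p)) := by
  have hN : 0 < N := by omega
  obtain ⟨hSpos, hSext⟩ := (mem_primalSet_iff hnN hC).mp hSig
  have hcomm := commute_scalar_banded hN p Q
  have hci := hQ.commute_inv_right hcomm
  have h := hP.trace_mul_log_lt (hP.inv_mul_of_commute hQ hcomm) hSpos
    (hci.mul_right (Commute.refl _)) hne
  have hPd := (Matrix.isUnit_iff_isUnit_det _).mp hP.isUnit
  have hQd := (Matrix.isUnit_iff_isUnit_det _).mp hQ.isUnit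
  rw [Matrix.mul_inv_rev, Matrix.nonsing_inv_nonsing_inv _ hQd, ← Matrix.mul_assoc,
    Matrix.mul_nonsing_inv _ hPd, Matrix.one_mul, Matrix.trace_mul_comm (banded N Q), Matrix.sub_mul,
    Matrix.trace_sub, trace_mul_banded_of_isExtension hnN hC hSext,
    trace_mul_banded_of_isExtension hnN hC hext, sub_self, Complex.zero_re, add_zero] at h
  exact h

lemma convex_dualSet : Convex ℝ (dualSet m n N) := by
  rintro _ ⟨hA, Q, rfl⟩ _ ⟨hB, Q', rfl⟩ a b ha hb hab
  refine ⟨?_, a • Q + b • Q', by rw [banded_add, banded_smul, banded_smul]⟩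
  rcases ha.eq_or_lt with rfl | ha
  · rw [zero_add] at hab
    simpa [hab] using hB
  · exact (hA.smul ha).add_posSemidef (hB.posSemidef.smul hb)

/-- Compare `A` and `B` with the tangent at X = aA + bB, which again commutes with `P`. In the
weighted sum the linear terms cancel because a(A − X) + b(B − X) = 0. -/
lemma strictConvexOn_dual (hN : 0 < N) (C : BigMatrix m N)
    {p : Fin (n + 1) → ℂ} (hP : (banded N (scalarCoeffs m p)).PosDef) :
    StrictConvexOn ℝ (dualSet m n N) (dual C (banded N (scalarCoeffs m p))) := by
  refine ⟨convex_dualSet, fun A hA B hB hAB a b ha hb hab => ?_⟩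
  set X := a • A + b • B with hXdef
  obtain ⟨hXpos, QX, hQX⟩ : X ∈ dualSet m n N := convex_dualSet hA hB ha.le hb.le hab
  have hc : Commute (banded N (scalarCoeffs m p)) X := by
    rw [hQX]; exact commute_scalar_banded hN p QX
  have hAX : A - X = b • (A - B) := by
    rw [hXdef, show a = 1 - b by linarith]; module
  have hBX : B - X = (-a) • (A - B) := by
    rw [hXdef, show b = 1 - a by linarith]; module
  have hAne : A ≠ X := fun h => by
    rw [← sub_eq_zero, hAX, smul_eq_zero, sub_eq_zero] at h
    exact h.elim hb.ne' hAB
  have hBne : B ≠ X := fun h => by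
    rw [← sub_eq_zero, hBX, smul_eq_zero, sub_eq_zero] at h
    exact h.elim (neg_ne_zero.mpr ha.ne') hAB
  have h1 := hP.trace_mul_log_lt hXpos hA.1 hc hAne
  have h2 := hP.trace_mul_log_lt hXpos hB.1 hc hBne
  rw [hAX, Matrix.mul_smul, Matrix.trace_smul, Complex.smul_re, smul_eq_mul] at h1
  rw [hBX, Matrix.mul_smul, Matrix.trace_smul, Complex.smul_re, smul_eq_mul] at h2
  have hCX : (C * X).trace.re = a * (C * A).trace.re + b * (C * B).trace.re := by
    rw [hXdef, Matrix.mul_add, Matrix.mul_smul, Matrix.mul_smul, Matrix.trace_add,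
      Matrix.trace_smul, Matrix.trace_smul, Complex.add_re, Complex.smul_re, Complex.smul_re,
      smul_eq_mul, smul_eq_mul]
  simp only [dual, matrixLog, hCX, smul_eq_mul]
  have h1' := mul_lt_mul_of_pos_left h1 ha
  have h2' := mul_lt_mul_of_pos_left h2 hb
  have hsum : ∀ r : ℝ, a * r + b * r = r := fun r => by rw [← add_mul, hab, one_mul]
  have := hsum ((banded N (scalarCoeffs m p) * cfc Real.log X).trace.re)
  linarith

end BlockCirculant

end

theorem theorem9 {m n N : ℕ} (hm : 0 < m) (hnN : n < N)
    (C : Coeffs m n) (hC : C ∈ dualCone m n N)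
    (p : Fin (n + 1) → ℂ) (hp : scalarCoeffs 1 p ∈ posCone 1 n N)
    (hP : (banded N (scalarCoeffs m p)).PosDef) :
    (∃! Q : Coeffs m n, (banded N Q).PosDef ∧
      IsExtension C ((banded N Q)⁻¹ * banded N (scalarCoeffs m p))) ∧
    (∀ Q : Coeffs m n, (banded N Q).PosDef →
      IsExtension C ((banded N Q)⁻¹ * banded N (scalarCoeffs m p)) →
      ((banded N Q)⁻¹ * banded N (scalarCoeffs m p) ∈ primalSet N C ∧
        ∀ Sig ∈ primalSet N C, Sig ≠ (banded N Q)⁻¹ * banded N (scalarCoeffs m p) →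
          primal (banded N (scalarCoeffs m p)) Sig <
            primal (banded N (scalarCoeffs m p))
              ((banded N Q)⁻¹ * banded N (scalarCoeffs m p))) ∧
      (banded N Q ∈ dualSet m n N ∧
        ∀ A ∈ dualSet m n N, A ≠ banded N Q →
          dual (banded N C) (banded N (scalarCoeffs m p)) (banded N Q) <
            dual (banded N C) (banded N (scalarCoeffs m p)) A)) ∧
    StrictConvexOn ℝ (dualSet m n N)
      (dual (banded N C) (banded N (scalarCoeffs m p))) := by
  have hN : 0 < N := by omega
  obtain ⟨Q, hQ, hmin⟩ := exists_minimizer hnN hC hP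
  have hext := isExtension_of_isMin hnN hC.1 hP hQ hmin
  refine ⟨⟨Q, ⟨hQ, hext⟩, ?_⟩, ?_, strictConvexOn_dual hN _ hP⟩
  · rintro Q' ⟨hQ', hext'⟩
    by_contra hne
    have hne' : banded N Q' ≠ banded N Q := fun h => hne (banded_injective hnN h)
    -- Two distinct solutions would each have a strictly smaller dual value than the other.
    exact lt_asymm (dual_lt_of_isExtension hnN hC.1 hP hQ hext ⟨hQ', Q', rfl⟩ hne')
      (dual_lt_of_isExtension hnN hC.1 hP hQ' hext' ⟨hQ, Q, rfl⟩ hne'.symm)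
  · intro Q hQ hext
    exact ⟨⟨(mem_primalSet_iff hnN hC.1).mpr
        ⟨hP.inv_mul_of_commute hQ (commute_scalar_banded hN p Q), hext⟩,
      fun Sig hSig hne => primal_lt_of_isExtension hnN hC.1 hP hQ hext hSig hne⟩,
      ⟨hQ, Q, rfl⟩, fun A hA hne => dual_lt_of_isExtension hnN hC.1 hP hQ hext hA hne⟩
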